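/- **Lemma (stability of rank two parabolic bundles on $\mathbb{P}^1$).** Let $C=\mathbb{P}^1$ over $\mathbb{C}$, let $V=\mathcal{O}_C(k_1)\oplus\mathcal{O}_C(k_2)$, and let $p_1,\dots,p_n\in C$ be $n$ distinct points. Let $a,b$ be rational numbers with $-1<a\le b\le 0$. Let $\mathcal{V}=(V,\mathsf{F},(a,b))$ be a parabolic bundle with balanced weights along $p_1+\dots+p_n$: in each fibre $V_{p_i}$ one is given a line $F_i\subset V_{p_i}$ if $a<b$, and $F_i=0$ in the degenerate case $a=b$; the fibre $V_{p_i}$ is filtered by $F_i$ in weight $a$ and by $V_{p_i}$ in weight $b$. The parabolic degree of $\mathcal{V}$ is $\deg V-n(a+b)$. A parabolic line bundle $(L,\mathsf{e})$ with weights $e_i\in(-1,0]$ has parabolic degree $\deg L-\sum_i e_i$. The bundle $\mathcal{V}$ is semistable (respectively stable) if every saturated parabolic subsheaf $(L,\mathsf{e})\subset\mathcal{V}$ of rank one (that is, at every parabolic level $t$ one has $L_t\subset V_t$ with torsion-free quotient) satisfies $$\deg L-\sum_i e_i\;\le\;\tfrac12\bigl(\deg V-n(a+b)\bigr)\qquad(\text{respectively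 } <).$$ Let $\gamma:\mathbb{P}(V)\to C$ be the ruled surface of lines in the fibres of $V$, let $\mathcal{O}_V(1)$ be the line bundle on it with $\gamma_*\mathcal{O}_V(1)=V^\vee$, and regard the lines $F_i$ as points of $\mathbb{P}(V)$. For $d\in\mathbb{Z}$ let $\mathsf{k}_d(\mathcal{V})$ be the maximal number of flag points $F_i$ that lie on a curve $D$, where $D$ runs over the irreducible curves in the linear system $|\mathcal{O}_V(1)\otimes\gamma^*\mathcal{O}_C(\deg V+d)|$. (If $a=b$ there are no flag points, and the number is $0$.) Then $\mathcal{V}$ is semistable if and only if $$(b-a)\,\mathsf{k}_d(\mathcal{V})\;\le\;\tfrac12\deg V+(b-a)\tfrac n2+d$$ for all integers $d\ge\min\{-k_1,-k_2\}$ for which this linear system contains an irreducible curve (for the other $d$ the number $\mathsf{k}_d(\mathcal{V})$ is not defined and the condition is vacuous). Furthermore, $\mathcal{V}$ is stable if and only if the inequality is strict for all these $d$. -/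

import Mathlib

open scoped WithZero Polynomial LinearAlgebra.Projectivization

noncomputable section

namespace ParP1

/-! ### The curve `ℙ¹` over `ℂ`: closed points, function field, local orders -/

/-- The closed points of `ℙ¹ = ℂ ∪ {∞}`. -/
abbrev Pt : Type := OnePoint ℂ

/-- The function field of `ℙ¹`. -/
abbrev K : Type := RatFunc ℂ

/-- The maximal ideal `(X - c)` of `ℂ[X]`, i.e. the point `c` of the affine line. -/
def affinePoint (c : ℂ) : IsDedekindDomain.HeightOneSpectrum ℂ[X] where
  asIdeal := Ideal.span {Polynomial.X - Polynomial.C c}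
  isPrime := by
    rw [Ideal.span_singleton_prime (Polynomial.X_sub_C_ne_zero c)]
    exact Polynomial.prime_X_sub_C c
  ne_bot := by
    rw [ne_eq, Ideal.span_singleton_eq_bot]
    exact Polynomial.X_sub_C_ne_zero c

open scoped Classical in
/-- The (multiplicative) discrete valuation of `ℂ(X)` attached to a point `q` of `ℙ¹`:
`val q f = exp (- ord_q f)` for `f ≠ 0`, and `val q 0 = 0`. -/
def val (q : Pt) : Valuation K ℤᵐ⁰ :=
  OnePoint.elim q (RatFunc.inftyValuation ℂ) (fun c => (affinePoint c).valuation K)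

theorem val_algebraMap_le_one (q : Pt) (c : ℂ) : val q (algebraMap ℂ K c) ≤ 1 := by
  classical
  induction q using OnePoint.rec with
  | infty =>
    by_cases hc : c = 0
    · simp [hc]
    · change RatFunc.inftyValuation ℂ (RatFunc.C c) ≤ 1
      exact (RatFunc.inftyValuation.C ℂ hc).le
  | coe x =>
    change (affinePoint x).valuation K (algebraMap ℂ K c) ≤ 1
    rw [IsScalarTower.algebraMap_apply ℂ ℂ[X] K]
    exact (affinePoint x).valuation_le_one _

/-- Divisors on `ℙ¹`. -/
abbrev Divisor : Type := Pt →₀ ℤ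

/-- The degree of a divisor on `ℙ¹`. -/
def Divisor.degree (D : Divisor) : ℤ := D.sum fun _ m => m

/-- The divisor `m · ∞`, so that `𝒪(m) = 𝒪(m · ∞)`. -/
def hyp (m : ℤ) : Divisor := Finsupp.single OnePoint.infty m

/-- The stalk at `q` of the invertible sheaf `𝒪(D)`, as a subspace of the function field:
all `f` with `f = 0` or `ord_q f ≥ - D q`. -/
def stalkO (D : Divisor) (q : Pt) : Submodule ℂ K where
  carrier := {f | val q f ≤ WithZero.exp (D q)}
  zero_mem' := by simp
  add_mem' := fun {f g} hf hg => (val q).map_add_le hf hg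
  smul_mem' := fun c f hf => by
    rw [Set.mem_ofPred_eq, Algebra.smul_def, map_mul]
    calc val q (algebraMap ℂ K c) * val q f ≤ 1 * WithZero.exp (D q) :=
          mul_le_mul' (val_algebraMap_le_one q c) hf
      _ = WithZero.exp (D q) := one_mul _

/-! ### The bundle `V = 𝒪(k₁) ⊕ 𝒪(k₂)` and its projectivization

Coherent subsheaves of the constant sheaf `K²` are described by their stalks. -/

/-- The stalk at `q` of `V ⊗ 𝒪(D)`, where `V = 𝒪(k₁) ⊕ 𝒪(k₂)`. -/
def twistStalk (k₁ k₂ : ℤ) (D : Divisor) (q : Pt) : Submodule ℂ (Fin 2 → K) :=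
  Submodule.pi Set.univ ![stalkO (hyp k₁ + D) q, stalkO (hyp k₂ + D) q]

/-- The stalk `V_q` of `V = 𝒪(k₁) ⊕ 𝒪(k₂)`. -/
def stalkV (k₁ k₂ : ℤ) (q : Pt) : Submodule ℂ (Fin 2 → K) := twistStalk k₁ k₂ 0 q

/-- The fibre of `V` at `q`: the stalk of `V` modulo the stalk of `V(-q)`
(which is `𝔪_q V_q`). -/
abbrev Fibre (k₁ k₂ : ℤ) (q : Pt) : Type :=
  stalkV k₁ k₂ q ⧸ (twistStalk k₁ k₂ (-Finsupp.single q 1) q).submoduleOf (stalkV k₁ k₂ q)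

/-- The value at `q` of a germ of a section of `V` at `q`. -/
def evalAt (k₁ k₂ : ℤ) (q : Pt) : stalkV k₁ k₂ q →ₗ[ℂ] Fibre k₁ k₂ q := Submodule.mkQ _

/-- `deg V` for `V = 𝒪(k₁) ⊕ 𝒪(k₂)`. -/
def degV (k₁ k₂ : ℤ) : ℤ := k₁ + k₂

/-- The (closed) points of the ruled surface `ℙ(V)`: a point `base` of the curve together with
a line in the fibre of `V` at `base`. -/
structure PV (k₁ k₂ : ℤ) where
  /-- the image under the projection `γ : ℙ(V) → ℙ¹` -/
  base : Pt
  /-- the line in the fibre of `V` -/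
  line : ℙ ℂ (Fibre k₁ k₂ base)

/-- `F` is a global section of `𝒪_V(j) ⊗ γ^* 𝒪(m)` on `ℙ(V)`, i.e. of `Sym^j V^∨ ⊗ 𝒪(m)` on the
curve: a homogeneous form of degree `j` over the function field, on the generic fibre `K²` of
`V`, which at every point `q` maps `V_q` into `𝒪(m)_q`. -/
def IsSection (k₁ k₂ : ℤ) (j : ℕ) (m : ℤ) (F : MvPolynomial (Fin 2) K) : Prop :=
  F.IsHomogeneous j ∧
    ∀ q : Pt, ∀ v ∈ stalkV k₁ k₂ q, MvPolynomial.eval v F ∈ stalkO (hyp m) q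

/-- The zero locus in `ℙ(V)` of a section `F` of `𝒪_V(j) ⊗ γ^* 𝒪(m)`: the points `(q, ℓ)` such
that the form induced by `F` on the fibre of `V` at `q`, with values in the fibre
`𝒪(m)_q / 𝒪(m)(-q)_q`, vanishes on the line `ℓ`. -/
def zeroLocus (k₁ k₂ : ℤ) (m : ℤ) (F : MvPolynomial (Fin 2) K) : Set (PV k₁ k₂) :=
  {x | ∀ v : stalkV k₁ k₂ x.base, evalAt k₁ k₂ x.base v ∈ x.line.submodule →
    MvPolynomial.eval (v : Fin 2 → K) F ∈ stalkO (hyp m - Finsupp.single x.base 1) x.base}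

/-- The Zariski topology on `ℙ(V)`, generated by the non-vanishing loci of sections of the
line bundles `𝒪_V(j) ⊗ γ^* 𝒪(m)` (these include all powers of an ample line bundle). -/
instance zariski (k₁ k₂ : ℤ) : TopologicalSpace (PV k₁ k₂) :=
  TopologicalSpace.generateFrom
    {U | ∃ (j : ℕ) (m : ℤ) (F : MvPolynomial (Fin 2) K),
      IsSection k₁ k₂ j m F ∧ U = (zeroLocus k₁ k₂ m F)ᶜ}

/-- The members of the linear system `|𝒪_V(1) ⊗ γ^* 𝒪(m)|`, as closed subsets of `ℙ(V)`.
(The zero divisor of a nonzero section has exactly one component that is not a fibre of `γ`, and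
that one has multiplicity one; so the divisor is irreducible and reduced as soon as its support
is an irreducible set.) -/
def linearSystem (k₁ k₂ : ℤ) (m : ℤ) : Set (Set (PV k₁ k₂)) :=
  {Z | ∃ F : MvPolynomial (Fin 2) K, F ≠ 0 ∧ IsSection k₁ k₂ 1 m F ∧ Z = zeroLocus k₁ k₂ m F}

/-- The irreducible curves in the linear system `|𝒪_V(1) ⊗ γ^* 𝒪(m)|`. -/
def irreducibleCurves (k₁ k₂ : ℤ) (m : ℤ) : Set (Set (PV k₁ k₂)) :=
  {Z | Z ∈ linearSystem k₁ k₂ m ∧ IsIrreducible Z}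

/-! ### Parabolic structures -/

/-- A parabolic structure on `V = 𝒪(k₁) ⊕ 𝒪(k₂)` along the points `p i`: weights
`-1 < a i ≤ b i ≤ 0`, and in the fibre at `p i` a line if `a i < b i`, and `0` in the degenerate
case `a i = b i`. -/
structure Parabolic (k₁ k₂ : ℤ) {n : ℕ} (p : Fin n → Pt) where
  a : Fin n → ℝ
  b : Fin n → ℝ
  neg_one_lt : ∀ i, -1 < a i
  le : ∀ i, a i ≤ b i
  nonpos : ∀ i, b i ≤ 0
  flag : ∀ i, Submodule ℂ (Fibre k₁ k₂ (p i))
  finrank_flag : ∀ i, a i < b i → Module.finrank ℂ (flag i) = 1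
  flag_eq_bot : ∀ i, a i = b i → flag i = ⊥

/-- A coherent subsheaf of rank one of the constant sheaf `K²`, in the form `𝒪(D) · w` with a
divisor `D` and `0 ≠ w ∈ K²` (every invertible sheaf on a smooth curve is some `𝒪(D)`, and a
monomorphism from it to `K²` is the multiplication by some `w`), together with a parabolic
weight `e i ∈ (-1, 0]` at each of the `n` points. -/
structure ParLine (n : ℕ) where
  D : Divisor
  w : Fin 2 → K
  w_ne_zero : w ≠ 0
  e : Fin n → ℝ
  neg_one_lt : ∀ i, -1 < e i
  nonpos : ∀ i, e i ≤ 0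

/-- The parabolic levels of the truncation `(-1, 0]ⁿ`, which determine a parabolic sheaf. -/
def IsLevel {n : ℕ} (t : Fin n → ℝ) : Prop := ∀ i, -1 < t i ∧ t i ≤ 0

/-- The stalk at `q` of the level sheaf `L_t = 𝒪(D + ∑ ⌊t i - e i⌋ p i) · w` of the parabolic
line bundle `L`. -/
def ParLine.levelStalk {n : ℕ} (p : Fin n → Pt) (L : ParLine n) (t : Fin n → ℝ) (q : Pt) :
    Submodule ℂ (Fin 2 → K) :=
  (stalkO (L.D + ∑ i, Finsupp.single (p i) ⌊t i - L.e i⌋) q).map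
    ((LinearMap.toSpanSingleton K (Fin 2 → K) L.w).restrictScalars ℂ)

/-- The parabolic degree of a parabolic line bundle. -/
def ParLine.pardeg {n : ℕ} (L : ParLine n) : ℝ := (L.D.degree : ℝ) - ∑ i, L.e i

namespace Parabolic

variable {k₁ k₂ : ℤ} {n : ℕ} {p : Fin n → Pt}

/-- The increasing filtration, with weights `a i` and `b i`, of the fibre of `V` at `p i`. -/
def fil (E : Parabolic k₁ k₂ p) (i : Fin n) (s : ℝ) : Submodule ℂ (Fibre k₁ k₂ (p i)) :=
  if s < E.a i then ⊥ else if s < E.b i then E.flag i else ⊤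

/-- The stalk at `q` of the level sheaf `V_t`, for levels `t ∈ (-1, 0]ⁿ`: the germs of sections of
`V` whose value at `p i`, if `q = p i`, lies in the step `t i` of the filtration. -/
def levelStalk (E : Parabolic k₁ k₂ p) (t : Fin n → ℝ) (q : Pt) : Submodule ℂ (Fin 2 → K) :=
  stalkV k₁ k₂ q ⊓
    ⨅ (i : Fin n) (_ : p i = q),
      ((E.fil i (t i)).comap (evalAt k₁ k₂ (p i))).map (stalkV k₁ k₂ (p i)).subtype

/-- `L` is a parabolic subsheaf: `L_t ⊆ V_t` at every level `t`. -/
def IsSubsheaf (E : Parabolic k₁ k₂ p) (L : ParLine n) : Prop :=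
  ∀ t, IsLevel t → ∀ q, L.levelStalk p t q ≤ E.levelStalk t q

/-- `L` is a saturated parabolic subsheaf: in addition the quotient `V_t / L_t` is torsion free
at every level `t`. -/
def IsSaturatedSubsheaf (E : Parabolic k₁ k₂ p) (L : ParLine n) : Prop :=
  E.IsSubsheaf L ∧ ∀ t, IsLevel t → ∀ q, ∀ v ∈ E.levelStalk t q, ∀ r : K, r ≠ 0 → val q r ≤ 1 →
    r • v ∈ L.levelStalk p t q → v ∈ L.levelStalk p t q

/-- The parabolic degree of the parabolic bundle. -/
def pardeg (E : Parabolic k₁ k₂ p) : ℝ := (degV k₁ k₂ : ℝ) - ∑ i, (E.a i + E.b i)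

/-- The parabolic slope of the (rank two) parabolic bundle. -/
def slope (E : Parabolic k₁ k₂ p) : ℝ := E.pardeg / 2

/-- Slope semistability. The proper nonzero saturated subsheaves of a bundle of rank two have rank
one, and then the parabolic slope is the parabolic degree. -/
def Semistable (E : Parabolic k₁ k₂ p) : Prop :=
  ∀ L : ParLine n, E.IsSaturatedSubsheaf L → L.pardeg ≤ E.slope

/-- Slope stability. -/
def Stable (E : Parabolic k₁ k₂ p) : Prop :=
  ∀ L : ParLine n, E.IsSaturatedSubsheaf L → L.pardeg < E.slope

/-- `#(F ∩ Z)`: the number of flags (viewed as points of `ℙ(V)`) that lie on `Z`. -/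
def count (E : Parabolic k₁ k₂ p) (Z : Set (PV k₁ k₂)) : ℕ :=
  Set.ncard {i : Fin n | ∃ l : ℙ ℂ (Fibre k₁ k₂ (p i)), l.submodule = E.flag i ∧ ⟨p i, l⟩ ∈ Z}

/-- `k_d`: the maximum of `#(F ∩ Z)` over the irreducible curves `Z` in the linear system
`|𝒪_V(1) ⊗ γ^* 𝒪(deg V + d)|`. (The set is bounded by `n`; so the supremum is a maximum whenever
there is such a curve.) -/
def kd (E : Parabolic k₁ k₂ p) (d : ℤ) : ℕ :=
  sSup (E.count '' irreducibleCurves k₁ k₂ (degV k₁ k₂ + d))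

end Parabolic

end ParP1

end

noncomputable section

namespace ParP1

open WithZero

/-! ### Divisors of rational functions -/

/-! A saturated parabolic subsheaf of rank one is determined by the line `K · w` that it spans in
the generic fibre `K²`. Its divisor is read off from the order of `w` at each point, measured by the
norm `vnorm` of the lattice `V_q`. Its weight at `p i` is `a` or `b` according to whether the fibre
of the saturated line is the flag or not (`isSaturatedSubsheaf_iff_inducedWeight`). On `ℙ¹` every
divisor of degree zero is principal, so `w` can be rescaled until the saturation is `𝒪(-d · ∞) · w`,
that is, until `w` is primitive of degree `d`.

The determinant turns such a `w` into the linear form `v ↦ w ∧ v`, a section of `𝒪_V(1) ⊗ γ^* 𝒪(deg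
V + d)` that vanishes on no fibre. Its zero locus is the curve of the line subbundle. This curve is
irreducible, because a closed set meets it in finitely many points or contains it. Conversely, every
section of the linear system is `w ∧ ·` for some `w`; if `w` is not primitive, a whole fibre splits
off and the zero locus is reducible (`not_isIrreducible_of_lt`).

A subsheaf whose curve carries `c` flags thus has parabolic degree `-d - n b + (b - a) c`, and
comparing this with the slope gives the inequality for `c`. Since `a ≤ b`, the largest `c` for each
`d` decides. -/

theorem Divisor.degree_add (D E : Divisor) : (D + E).degree = D.degree + E.degree :=
  Finsupp.sum_add_index' (fun _ => rfl) fun _ _ _ => rfl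

theorem Divisor.degree_zero : (0 : Divisor).degree = 0 := Finsupp.sum_zero_index

theorem Divisor.degree_neg (D : Divisor) : (-D).degree = -D.degree := by
  have h := Divisor.degree_add D (-D)
  rw [add_neg_cancel, Divisor.degree_zero] at h
  linarith

theorem Divisor.degree_single (q : Pt) (m : ℤ) : Divisor.degree (Finsupp.single q m) = m :=
  Finsupp.sum_single_index rfl

theorem Divisor.degree_hyp (m : ℤ) : (hyp m).degree = m := Divisor.degree_single _ _

theorem Divisor.degree_le_degree {D E : Divisor} (h : ∀ q, D q ≤ E q) :
    D.degree ≤ E.degree := by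
  have key : 0 ≤ (E - D).degree :=
    Finset.sum_nonneg fun q _ => by simpa using h q
  rw [sub_eq_add_neg, Divisor.degree_add, Divisor.degree_neg] at key
  linarith

/-- `X - c` has a simple zero at `c` and, being of degree one, a simple pole at `∞`. -/
theorem val_X_sub_C (c : ℂ) (q : Pt) :
    val q (algebraMap ℂ[X] K (Polynomial.X - Polynomial.C c)) =
      exp (-((Finsupp.single (c : Pt) 1 - hyp 1 : Divisor) q)) := by
  classical
  have hne : (Polynomial.X - Polynomial.C c : ℂ[X]) ≠ 0 := Polynomial.X_sub_C_ne_zero c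
  induction q using OnePoint.rec with
  | infty =>
    change RatFunc.inftyValuation ℂ _ = _
    rw [RatFunc.inftyValuation_apply, RatFunc.inftyValuation.polynomial ℂ hne]
    simp [hyp]
  | coe x =>
    change (affinePoint x).valuation K _ = _
    rw [IsDedekindDomain.HeightOneSpectrum.valuation_of_algebraMap]
    by_cases h : x = c
    · subst h
      rw [IsDedekindDomain.HeightOneSpectrum.intValuation_singleton _ hne rfl]
      simp [hyp]
    · have h' : (c : Pt) ≠ (x : Pt) := fun e => h (OnePoint.coe_injective e).symm
      have : (affinePoint x).intValuation (Polynomial.X - Polynomial.C c) = 1 := by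
        rw [IsDedekindDomain.HeightOneSpectrum.intValuation_eq_one_iff]
        change _ ∉ Ideal.span {Polynomial.X - Polynomial.C x}
        rw [Ideal.mem_span_singleton, Polynomial.dvd_iff_isRoot]
        simpa [sub_eq_zero] using h
      rw [this]
      simp [hyp, h']

/-- `f` is a nonzero rational function with divisor `D`. -/
def HasDiv (f : K) (D : Divisor) : Prop := ∀ q, val q f = exp (-(D q))

theorem HasDiv.ne_zero {f : K} {D : Divisor} (h : HasDiv f D) : f ≠ 0 := by
  rintro rfl
  have := h OnePoint.infty
  rw [map_zero] at this
  exact exp_ne_zero this.symm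

theorem HasDiv.mul {f g : K} {D E : Divisor} (hf : HasDiv f D) (hg : HasDiv g E) :
    HasDiv (f * g) (D + E) := fun q => by
  rw [map_mul, hf q, hg q, ← exp_add]
  congr 1
  rw [Finsupp.add_apply]
  ring

theorem HasDiv.inv {f : K} {D : Divisor} (hf : HasDiv f D) : HasDiv f⁻¹ (-D) := fun q => by
  rw [map_inv₀, hf q, ← exp_neg]
  rfl

theorem HasDiv.one : HasDiv 1 0 := fun q => by simp

theorem HasDiv.zpow {f : K} {D : Divisor} (hf : HasDiv f D) (m : ℤ) :
    HasDiv (f ^ m) (m • D) := fun q => by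
  rw [map_zpow₀, hf q, ← exp_zsmul]
  simp

theorem hasDiv_X_sub_C (c : ℂ) :
    HasDiv (algebraMap ℂ[X] K (Polynomial.X - Polynomial.C c))
      (Finsupp.single (c : Pt) 1 - hyp 1) := val_X_sub_C c

theorem hasDiv_algebraMap {c : ℂ} (hc : c ≠ 0) : HasDiv (algebraMap ℂ K c) 0 := fun q => by
  have h1 := val_algebraMap_le_one q c
  have h2 := val_algebraMap_le_one q c⁻¹
  have h3 : val q (algebraMap ℂ K c) * val q (algebraMap ℂ K c⁻¹) = 1 := by
    rw [← map_mul, ← map_mul, mul_inv_cancel₀ hc, map_one, map_one]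
  simp only [Finsupp.coe_zero, Pi.zero_apply, neg_zero, exp_zero]
  refine le_antisymm h1 ?_
  calc (1 : ℤᵐ⁰) = _ := h3.symm
    _ ≤ val q (algebraMap ℂ K c) * 1 := mul_le_mul_right h2 _
    _ = _ := mul_one _

/-- Over `ℂ` a polynomial splits into linear factors, each of which has a divisor of degree zero. -/
theorem exists_hasDiv_polynomial {P : ℂ[X]} (hP : P ≠ 0) :
    ∃ D : Divisor, D.degree = 0 ∧ HasDiv (algebraMap ℂ[X] K P) D := by
  have hroots : ∀ s : Multiset ℂ, ∃ D : Divisor, D.degree = 0 ∧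
      HasDiv (algebraMap ℂ[X] K (s.map fun a => Polynomial.X - Polynomial.C a).prod) D := by
    intro s
    induction s using Multiset.induction_on with
    | empty => exact ⟨0, Divisor.degree_zero, by simpa using HasDiv.one⟩
    | cons a s ih =>
      obtain ⟨D, hD, h⟩ := ih
      refine ⟨(Finsupp.single (a : Pt) 1 - hyp 1) + D, ?_, ?_⟩
      · rw [Divisor.degree_add, hD, sub_eq_add_neg, Divisor.degree_add, Divisor.degree_neg,
          Divisor.degree_hyp, Divisor.degree_single]
        norm_num
      · rw [Multiset.map_cons, Multiset.prod_cons, map_mul]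
        exact (hasDiv_X_sub_C a).mul h
  obtain ⟨D, hD, h⟩ := hroots P.roots
  refine ⟨D, hD, ?_⟩
  rw [(IsAlgClosed.splits P).eq_prod_roots, map_mul]
  have hc : HasDiv (algebraMap ℂ[X] K (Polynomial.C P.leadingCoeff)) 0 :=
    hasDiv_algebraMap (Polynomial.leadingCoeff_ne_zero.mpr hP)
  simpa using hc.mul h

theorem exists_hasDiv {f : K} (hf : f ≠ 0) : ∃ D : Divisor, D.degree = 0 ∧ HasDiv f D := by
  obtain ⟨D, hD, h⟩ := exists_hasDiv_polynomial (RatFunc.num_ne_zero hf)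
  obtain ⟨E, hE, h'⟩ := exists_hasDiv_polynomial (RatFunc.denom_ne_zero f)
  refine ⟨D + -E, by rw [Divisor.degree_add, Divisor.degree_neg, hD, hE]; rfl, ?_⟩
  rw [← RatFunc.num_div_denom f, div_eq_mul_inv]
  exact h.mul h'.inv

/-- This is `Pic ℙ¹ = ℤ`: a power of `X - x` moves a multiple of the point `x` to `∞`. -/
theorem exists_hasDiv_sub_hyp (D : Divisor) : ∃ f : K, HasDiv f (D - hyp D.degree) := by
  induction D using Finsupp.induction_linear with
  | zero => exact ⟨1, by simpa [Divisor.degree_zero, hyp] using HasDiv.one⟩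
  | add D E hD hE =>
    obtain ⟨f, hf⟩ := hD
    obtain ⟨g, hg⟩ := hE
    refine ⟨f * g, ?_⟩
    convert hf.mul hg using 1
    rw [Divisor.degree_add]
    simp only [hyp, Finsupp.single_add]
    abel
  | single q m =>
    rw [Divisor.degree_single]
    induction q using OnePoint.rec with
    | infty => exact ⟨1, by simpa [hyp] using HasDiv.one⟩
    | coe x =>
      refine ⟨algebraMap ℂ[X] K (Polynomial.X - Polynomial.C x) ^ m, ?_⟩
      convert (hasDiv_X_sub_C x).zpow m using 1
      simp [hyp, smul_sub]

theorem exists_hasDiv_of_degree_eq_zero {D : Divisor} (hD : D.degree = 0) :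
    ∃ f : K, HasDiv f D := by
  obtain ⟨f, hf⟩ := exists_hasDiv_sub_hyp D
  exact ⟨f, by simpa [hD, hyp] using hf⟩

theorem exists_val_eq_exp (q : Pt) (m : ℤ) : ∃ f : K, val q f = exp m := by
  -- A second point absorbs the opposite order, so that the degree is zero.
  obtain ⟨q', hq'⟩ := exists_ne q
  obtain ⟨f, hf⟩ := exists_hasDiv_of_degree_eq_zero
    (D := Finsupp.single q (-m) + Finsupp.single q' m)
    (by rw [Divisor.degree_add, Divisor.degree_single, Divisor.degree_single]; ring)
  exact ⟨f, by rw [hf q]; simp [hq']⟩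

theorem finite_val_ne_one {f : K} (hf : f ≠ 0) : {q | val q f ≠ 1}.Finite := by
  obtain ⟨D, -, hD⟩ := exists_hasDiv hf
  refine D.support.finite_toSet.subset fun q hq => ?_
  rw [Finset.mem_coe, Finsupp.mem_support_iff]
  rintro h
  exact hq (by rw [hD q, h, neg_zero, exp_zero])

/-! ### Value group, residue fields and bounds for polynomials -/

theorem exists_eq_exp {x : ℤᵐ⁰} (hx : x ≠ 0) : ∃ m : ℤ, x = exp m := ⟨log x, (exp_log hx).symm⟩

theorem lt_exp_iff (x : ℤᵐ⁰) (m : ℤ) : x < exp m ↔ x ≤ exp (m - 1) := by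
  by_cases hx : x = 0
  · simp only [hx, zero_le, iff_true]
    exact exp_pos
  · obtain ⟨k, rfl⟩ := exists_eq_exp hx
    rw [exp_lt_exp, exp_le_exp]
    omega

theorem lt_one_iff_le_exp (x : ℤᵐ⁰) : x < 1 ↔ x ≤ exp (-1 : ℤ) := by
  simpa using lt_exp_iff x 0

theorem mul_exp_le_exp_iff (x : ℤᵐ⁰) (a b : ℤ) : x * exp a ≤ exp b ↔ x ≤ exp (b - a) := by
  by_cases hx : x = 0
  · simp [hx]
  · obtain ⟨k, rfl⟩ := exists_eq_exp hx
    rw [← exp_add, exp_le_exp, exp_le_exp]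
    omega

/-- The residue field at every point of `ℙ¹` is `ℂ`. -/
theorem exists_val_sub_lt_one (q : Pt) {r : K} (hr : val q r ≤ 1) :
    ∃ c : ℂ, val q (r - algebraMap ℂ K c) < 1 := by
  classical
  have hd : algebraMap ℂ[X] K r.denom ≠ 0 := by simpa using RatFunc.denom_ne_zero r
  have hrep : ∀ c : ℂ, r - algebraMap ℂ K c =
      algebraMap ℂ[X] K (r.num - Polynomial.C c * r.denom) / algebraMap ℂ[X] K r.denom := by
    intro c
    have : algebraMap ℂ K c = algebraMap ℂ[X] K (Polynomial.C c) := rfl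
    rw [map_sub, map_mul, sub_div, mul_div_cancel_right₀ _ hd, RatFunc.num_div_denom, this]
  induction q using OnePoint.rec with
  | infty =>
    -- The denominator is monic and the numerator has no larger degree, so this coefficient is the
    -- value of `r` at `∞`.
    refine ⟨r.num.coeff r.denom.natDegree, ?_⟩
    rw [hrep]
    set c := r.num.coeff r.denom.natDegree with hc
    by_cases h0 : r.num - Polynomial.C c * r.denom = 0
    · simp [h0]
    by_cases hr0 : r = 0
    · simp [hr0] at hc
      simp [hr0, hc]
    have hdeg : r.num.natDegree ≤ r.denom.natDegree := by
      change RatFunc.inftyValuation ℂ r ≤ 1 at hr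
      rw [RatFunc.inftyValuation_apply, RatFunc.inftyValuation_of_nonzero ℂ hr0,
        ← exp_zero, exp_le_exp, RatFunc.intDegree] at hr
      omega
    have hmonic := RatFunc.monic_denom r
    have hlt : (r.num - Polynomial.C c * r.denom).natDegree < r.denom.natDegree := by
      have hle : (r.num - Polynomial.C c * r.denom).natDegree ≤ r.denom.natDegree :=
        (Polynomial.natDegree_sub_le _ _).trans
          (max_le hdeg (Polynomial.natDegree_C_mul_le _ _))
      refine lt_of_le_of_ne hle fun he => ?_
      refine h0 (Polynomial.leadingCoeff_eq_zero.mp ?_)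
      rw [Polynomial.leadingCoeff, he, Polynomial.coeff_sub, Polynomial.coeff_C_mul,
        hmonic.coeff_natDegree, mul_one, hc, sub_self]
    change RatFunc.inftyValuation ℂ _ < 1
    rw [map_div₀, RatFunc.inftyValuation_apply, RatFunc.inftyValuation_apply,
      RatFunc.inftyValuation.polynomial ℂ h0,
      RatFunc.inftyValuation.polynomial ℂ (RatFunc.denom_ne_zero r), ← exp_sub, ← exp_zero,
      exp_lt_exp]
    omega
  | coe x =>
    change (affinePoint x).valuation K r ≤ 1 at hr
    have hmem : ∀ P : ℂ[X], (affinePoint x).valuation K (algebraMap ℂ[X] K P) < 1 ↔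
        P.eval x = 0 := by
      intro P
      rw [IsDedekindDomain.HeightOneSpectrum.valuation_lt_one_iff_mem]
      change P ∈ Ideal.span {Polynomial.X - Polynomial.C x} ↔ _
      rw [Ideal.mem_span_singleton, Polynomial.dvd_iff_isRoot, Polynomial.IsRoot]
    have hone : ∀ P : ℂ[X], P.eval x ≠ 0 →
        (affinePoint x).valuation K (algebraMap ℂ[X] K P) = 1 := fun P hP =>
      le_antisymm ((affinePoint x).valuation_le_one P) (not_lt.mp fun h => hP ((hmem P).mp h))
    have hden : r.denom.eval x ≠ 0 := by
      intro h
      have hnum : r.num.eval x ≠ 0 := by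
        intro h'
        obtain ⟨u, v, huv⟩ := RatFunc.isCoprime_num_denom r
        have := congrArg (Polynomial.eval x) huv
        simp [h, h'] at this
      rw [← RatFunc.num_div_denom r, map_div₀, hone _ hnum, one_div] at hr
      have h1 := (hmem r.denom).mpr h
      have hpos : 0 < (affinePoint x).valuation K (algebraMap ℂ[X] K r.denom) := by
        rw [Valuation.pos_iff]
        exact hd
      exact absurd hr (not_le.mpr ((one_lt_inv₀ hpos).mpr h1))
    refine ⟨r.num.eval x / r.denom.eval x, ?_⟩
    rw [hrep]
    change (affinePoint x).valuation K _ < 1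
    rw [map_div₀, hone _ hden, div_one, hmem]
    simp [hden]

/-- A polynomial which is bounded on almost all constants is bounded on the valuation ring. -/
theorem val_eval_le (q : Pt) (M : ℤᵐ⁰) (P : K[X]) (S : Finset ℂ)
    (hP : ∀ c ∉ S, val q (P.eval (algebraMap ℂ K c)) ≤ M) {r : K} (hr : val q r ≤ 1) :
    val q (P.eval r) ≤ M := by
  induction hn : P.natDegree using Nat.strong_induction_on generalizing P S with
  | _ n ih =>
    rcases Nat.eq_zero_or_pos n with h0 | hpos
    · obtain ⟨c, hc⟩ := Infinite.exists_notMem_finset S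
      have := hP c hc
      rw [Polynomial.eq_C_of_natDegree_eq_zero (hn.trans h0)] at this ⊢
      simpa using this
    · obtain ⟨c, hc⟩ := exists_val_sub_lt_one q hr
      obtain ⟨c', hc'⟩ := Infinite.exists_notMem_finset (insert c S)
      rw [Finset.mem_insert, not_or] at hc'
      set x := algebraMap ℂ K c' with hx
      -- For a constant `y ≠ c'` the difference `y - x` is a unit at `q`, so the quotient `Q`, of
      -- smaller degree, obeys the same bound off the enlarged finite set.
      set Q := P /ₘ (Polynomial.X - Polynomial.C x) with hQ
      have hPQ : ∀ y, P.eval y = (y - x) * Q.eval y + P.eval x := by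
        intro y
        conv_lhs => rw [← Polynomial.modByMonic_add_div P (Polynomial.X - Polynomial.C x)]
        rw [Polynomial.modByMonic_X_sub_C_eq_C_eval]
        simp [hQ, add_comm]
      have hQr : val q (Q.eval r) ≤ M := by
        refine ih Q.natDegree ?_ Q (insert c' S) ?_ rfl
        · rw [hQ, Polynomial.natDegree_divByMonic _ (Polynomial.monic_X_sub_C x),
            Polynomial.natDegree_X_sub_C]
          omega
        · intro y hy
          rw [Finset.mem_insert, not_or] at hy
          have hv : val q (algebraMap ℂ K y - x) = 1 := by
            rw [hx, ← map_sub, hasDiv_algebraMap (sub_ne_zero.mpr hy.1) q]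
            simp
          have h1 : val q ((algebraMap ℂ K y - x) * Q.eval (algebraMap ℂ K y)) ≤ M := by
            rw [← add_sub_cancel_right (_ * _) (P.eval x), ← hPQ]
            exact (val q).map_sub_le (hP y hy.2) (hP c' hc'.2)
          rwa [map_mul, hv, one_mul] at h1
      rw [hPQ]
      refine (val q).map_add_le ?_ (hP c' hc'.2)
      rw [map_mul]
      have hrx : val q (r - x) ≤ 1 :=
        (val q).map_sub_le hr (val_algebraMap_le_one q c')
      calc val q (r - x) * val q (Q.eval r) ≤ 1 * M := mul_le_mul' hrx hQr
        _ = M := one_mul M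

/-- Write `P(y) - P(0) = y Q(y)`. Nonzero constants are units, so `Q` is bounded by `M` on them,
hence on the whole valuation ring. -/
theorem val_eval_sub_eval_zero_le (q : Pt) (M : ℤᵐ⁰) (P : K[X])
    (hP : ∀ c : ℂ, val q (P.eval (algebraMap ℂ K c)) ≤ M) {r : K} (hr : val q r ≤ 1) :
    val q (P.eval r - P.eval 0) ≤ val q r * M := by
  have hdiv : ∀ y, P.eval y - P.eval 0 = y * P.divX.eval y := by
    intro y
    have h : ∀ z, P.eval z = z * P.divX.eval z + P.coeff 0 := fun z => by
      conv_lhs => rw [← Polynomial.divX_mul_X_add P]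
      rw [Polynomial.eval_add, Polynomial.eval_mul_X, Polynomial.eval_C, mul_comm]
    rw [h y, h 0]
    ring
  rw [hdiv, map_mul]
  refine mul_le_mul_right (val_eval_le q M P.divX {0} ?_ hr) _
  intro c hc
  rw [Finset.mem_singleton] at hc
  have h0 := hP 0
  rw [map_zero] at h0
  have h1 := (val q).map_sub_le (hP c) h0
  rw [hdiv, map_mul, hasDiv_algebraMap hc q] at h1
  simpa using h1

section

/-! ### Germs of sections of `V` and lines in the fibres of `V` -/

/-- The norm on `K²` whose closed ball of radius `exp (D q)` is the stalk of `V ⊗ 𝒪(D)` at `q`. -/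
def vnorm (k₁ k₂ : ℤ) (q : Pt) (v : Fin 2 → K) : ℤᵐ⁰ :=
  max (val q (v 0) * exp (-(hyp k₁ q))) (val q (v 1) * exp (-(hyp k₂ q)))

/-- The determinant pairing on `K²`. -/
def wedge (w v : Fin 2 → K) : K := w 0 * v 1 - w 1 * v 0

section

variable {k₁ k₂ : ℤ} {q : Pt}

theorem hyp_add (m m' : ℤ) (q : Pt) : hyp (m + m') q = hyp m q + hyp m' q := by
  simp [hyp]

theorem hyp_sub (m m' : ℤ) (q : Pt) : hyp (m - m') q = hyp m q - hyp m' q := by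
  simp [hyp]

theorem hyp_neg (m : ℤ) (q : Pt) : hyp (-m) q = -hyp m q := by
  simp [hyp]

theorem hyp_of_ne (m : ℤ) {q : Pt} (hq : q ≠ OnePoint.infty) : hyp m q = 0 := by
  simp [hyp, hq]

theorem vnorm_le_exp_iff (m : ℤ) (v : Fin 2 → K) :
    vnorm k₁ k₂ q v ≤ exp m ↔
      val q (v 0) ≤ exp (hyp k₁ q + m) ∧ val q (v 1) ≤ exp (hyp k₂ q + m) := by
  rw [vnorm, max_le_iff, mul_exp_le_exp_iff, mul_exp_le_exp_iff, sub_neg_eq_add, sub_neg_eq_add,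
    add_comm m, add_comm m]

theorem mem_twistStalk_iff (D : Divisor) (v : Fin 2 → K) :
    v ∈ twistStalk k₁ k₂ D q ↔ vnorm k₁ k₂ q v ≤ exp (D q) := by
  rw [vnorm_le_exp_iff, twistStalk, Submodule.mem_pi]
  constructor
  · exact fun h => ⟨h 0 trivial, h 1 trivial⟩
  · rintro ⟨h0, h1⟩ i -
    fin_cases i
    · exact h0
    · exact h1

theorem mem_stalkV_iff (v : Fin 2 → K) : v ∈ stalkV k₁ k₂ q ↔ vnorm k₁ k₂ q v ≤ 1 := by
  rw [stalkV, mem_twistStalk_iff]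
  simp

theorem vnorm_smul (f : K) (v : Fin 2 → K) :
    vnorm k₁ k₂ q (f • v) = val q f * vnorm k₁ k₂ q v := by
  rw [vnorm, vnorm, mul_max]
  simp only [Pi.smul_apply, smul_eq_mul, map_mul, mul_assoc]

theorem vnorm_ne_zero {v : Fin 2 → K} (hv : v ≠ 0) : vnorm k₁ k₂ q v ≠ 0 := by
  intro h
  have h' : max (val q (v 0) * exp (-(hyp k₁ q))) (val q (v 1) * exp (-(hyp k₂ q))) ≤ 0 := h.le
  rw [max_le_iff] at h'
  simp only [le_zero_iff, mul_eq_zero, exp_ne_zero, or_false, map_eq_zero] at h'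
  refine hv (funext fun i => ?_)
  fin_cases i
  · exact h'.1
  · exact h'.2

theorem vnorm_sub_le (u v : Fin 2 → K) :
    vnorm k₁ k₂ q (u - v) ≤ max (vnorm k₁ k₂ q u) (vnorm k₁ k₂ q v) := by
  refine max_le ?_ ?_
  · rcases le_total (val q (u 0)) (val q (v 0)) with h | h
    · exact le_max_of_le_right (le_max_of_le_left
        (mul_le_mul_left ((val q).map_sub_le h le_rfl) _))
    · exact le_max_of_le_left (le_max_of_le_left
        (mul_le_mul_left ((val q).map_sub_le le_rfl h) _))
  · rcases le_total (val q (u 1)) (val q (v 1)) with h | h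
    · exact le_max_of_le_right (le_max_of_le_right
        (mul_le_mul_left ((val q).map_sub_le h le_rfl) _))
    · exact le_max_of_le_left (le_max_of_le_right
        (mul_le_mul_left ((val q).map_sub_le le_rfl h) _))

theorem val_apply_zero_le (v : Fin 2 → K) :
    val q (v 0) ≤ vnorm k₁ k₂ q v * exp (hyp k₁ q) := by
  calc val q (v 0) = val q (v 0) * exp (-(hyp k₁ q)) * exp (hyp k₁ q) := by
        rw [mul_assoc, ← exp_add, neg_add_cancel, exp_zero, mul_one]
    _ ≤ _ := mul_le_mul_left (le_max_left _ _) _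

theorem val_apply_one_le (v : Fin 2 → K) :
    val q (v 1) ≤ vnorm k₁ k₂ q v * exp (hyp k₂ q) := by
  calc val q (v 1) = val q (v 1) * exp (-(hyp k₂ q)) * exp (hyp k₂ q) := by
        rw [mul_assoc, ← exp_add, neg_add_cancel, exp_zero, mul_one]
    _ ≤ _ := mul_le_mul_left (le_max_right _ _) _

theorem vnorm_eq_or (v : Fin 2 → K) :
    val q (v 0) = vnorm k₁ k₂ q v * exp (hyp k₁ q) ∨
      val q (v 1) = vnorm k₁ k₂ q v * exp (hyp k₂ q) := by
  rcases max_choice (val q (v 0) * exp (-(hyp k₁ q))) (val q (v 1) * exp (-(hyp k₂ q))) with h | h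
  · left
    rw [vnorm, h, mul_assoc, ← exp_add, neg_add_cancel, exp_zero, mul_one]
  · right
    rw [vnorm, h, mul_assoc, ← exp_add, neg_add_cancel, exp_zero, mul_one]

/-- The determinant of `V` is `𝒪(k₁ + k₂)`. -/
theorem val_wedge_le (w v : Fin 2 → K) :
    val q (wedge w v) ≤ vnorm k₁ k₂ q w * vnorm k₁ k₂ q v * exp (hyp (k₁ + k₂) q) := by
  have h0 := val_apply_zero_le (k₁ := k₁) (k₂ := k₂) (q := q)
  have h1 := val_apply_one_le (k₁ := k₁) (k₂ := k₂) (q := q)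
  refine (val q).map_sub_le ?_ ?_
  · rw [map_mul, hyp_add, exp_add]
    calc _ ≤ _ := mul_le_mul' (h0 w) (h1 v)
      _ = _ := by ac_rfl
  · rw [map_mul, hyp_add, exp_add]
    calc _ ≤ _ := mul_le_mul' (h1 w) (h0 v)
      _ = _ := by ac_rfl

theorem wedge_smul_left (f : K) (w v : Fin 2 → K) : wedge (f • w) v = f * wedge w v := by
  simp [wedge]; ring

theorem wedge_smul_self_add (f : K) (w u : Fin 2 → K) : wedge w (f • w + u) = wedge w u := by
  simp [wedge]; ring

/-- The pairing `V ⊗ V → det V` is perfect: where one coordinate of `w` realises the norm, a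
generator of the other summand is a test vector. So the bound of `val_wedge_le` is sharp. -/
theorem exists_val_wedge_eq (w : Fin 2 → K) :
    ∃ v ∈ stalkV k₁ k₂ q, val q (wedge w v) = vnorm k₁ k₂ q w * exp (hyp (k₁ + k₂) q) := by
  rcases vnorm_eq_or (k₁ := k₁) (k₂ := k₂) (q := q) w with h | h
  · obtain ⟨y, hy⟩ := exists_val_eq_exp q (hyp k₂ q)
    refine ⟨![0, y], ?_, ?_⟩
    · rw [mem_stalkV_iff, ← exp_zero, vnorm_le_exp_iff]
      simp [hy]
    · simp [wedge, h, hy, hyp_add, mul_assoc]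
  · obtain ⟨y, hy⟩ := exists_val_eq_exp q (hyp k₁ q)
    refine ⟨![y, 0], ?_, ?_⟩
    · rw [mem_stalkV_iff, ← exp_zero, vnorm_le_exp_iff]
      simp [hy]
    · simp only [wedge, Matrix.cons_val_zero, Matrix.cons_val_one, mul_zero, zero_sub,
        Valuation.map_neg, map_mul, h, hy, hyp_add, exp_add]
      ac_rfl

/-! ### Fibres of `V` and lines in them -/

theorem evalAt_eq_evalAt_iff (u v : stalkV k₁ k₂ q) :
    evalAt k₁ k₂ q u = evalAt k₁ k₂ q v ↔
      vnorm k₁ k₂ q ((u : Fin 2 → K) - v) ≤ exp (-1 : ℤ) := by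
  rw [evalAt, Submodule.mkQ_apply, Submodule.mkQ_apply, Submodule.Quotient.eq,
    Submodule.submoduleOf, Submodule.mem_comap, mem_twistStalk_iff]
  simp

theorem evalAt_eq_zero_iff (u : stalkV k₁ k₂ q) :
    evalAt k₁ k₂ q u = 0 ↔ vnorm k₁ k₂ q (u : Fin 2 → K) ≤ exp (-1 : ℤ) := by
  simpa using evalAt_eq_evalAt_iff u 0

theorem evalAt_surjective : Function.Surjective (evalAt k₁ k₂ q) := Submodule.mkQ_surjective _

/-- The fibre at `q` of the saturation of `K · w` in `V`. -/
def lineAt (k₁ k₂ : ℤ) (w : Fin 2 → K) (q : Pt) : Submodule ℂ (Fibre k₁ k₂ q) :=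
  (((Submodule.span K {w}).restrictScalars ℂ).submoduleOf (stalkV k₁ k₂ q)).map (evalAt k₁ k₂ q)

theorem mem_lineAt_iff_exists (w : Fin 2 → K) (v : stalkV k₁ k₂ q) :
    evalAt k₁ k₂ q v ∈ lineAt k₁ k₂ w q ↔
      ∃ r : K, vnorm k₁ k₂ q (r • w) ≤ 1 ∧
        vnorm k₁ k₂ q ((v : Fin 2 → K) - r • w) ≤ exp (-1 : ℤ) := by
  constructor
  · rintro ⟨u, hu, huv⟩
    obtain ⟨r, hr⟩ := Submodule.mem_span_singleton.mp hu
    refine ⟨r, ?_, ?_⟩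
    · rw [hr]
      exact (mem_stalkV_iff _).mp u.2
    · rw [hr]
      exact (evalAt_eq_evalAt_iff v u).mp huv.symm
  · rintro ⟨r, h1, h2⟩
    exact ⟨⟨r • w, (mem_stalkV_iff _).mpr h1⟩, Submodule.mem_span_singleton.mpr ⟨r, rfl⟩,
      ((evalAt_eq_evalAt_iff v _).mpr h2).symm⟩

theorem lineAt_smul {g : K} (hg : g ≠ 0) (w : Fin 2 → K) :
    lineAt k₁ k₂ (g • w) q = lineAt k₁ k₂ w q := by
  rw [lineAt, lineAt, Submodule.span_singleton_smul_eq (IsUnit.mk0 g hg)]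

/-- Once `w` is normalised to norm one, the pairing with `w` is a nonzero form on the
two-dimensional fibre, whose kernel is the line of `w`. -/
theorem mem_lineAt_iff {w : Fin 2 → K} (hw : w ≠ 0) (v : stalkV k₁ k₂ q) :
    evalAt k₁ k₂ q v ∈ lineAt k₁ k₂ w q ↔
      val q (wedge w v) ≤ vnorm k₁ k₂ q w * exp (hyp (k₁ + k₂) q - 1) := by
  rw [mem_lineAt_iff_exists]
  obtain ⟨N, hN⟩ := exists_eq_exp (vnorm_ne_zero (k₁ := k₁) (k₂ := k₂) (q := q) hw)
  constructor
  · rintro ⟨r, -, h⟩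
    have : wedge w v = wedge w ((v : Fin 2 → K) - r • w) := by
      rw [← wedge_smul_self_add r w ((v : Fin 2 → K) - r • w), add_sub_cancel]
    rw [this]
    calc _ ≤ _ := val_wedge_le w _
      _ ≤ vnorm k₁ k₂ q w * exp (-1 : ℤ) * exp (hyp (k₁ + k₂) q) := by gcongr
      _ = _ := by rw [mul_assoc, ← exp_add]; congr 2; ring
  · intro h
    rw [hN, ← exp_add] at h
    -- If `r • w` is congruent to `v`, it lies in `V_q` by the ultrametric inequality.
    suffices ∃ r : K, vnorm k₁ k₂ q ((v : Fin 2 → K) - r • w) ≤ exp (-1 : ℤ) by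
      obtain ⟨r, hr⟩ := this
      refine ⟨r, ?_, hr⟩
      have h2 : r • w = (v : Fin 2 → K) - ((v : Fin 2 → K) - r • w) := by abel
      rw [h2]
      refine (vnorm_sub_le _ _).trans (max_le ((mem_stalkV_iff _).mp v.2) (hr.trans ?_))
      rw [← exp_zero, exp_le_exp]
      norm_num
    have hne : ∀ x : K, ∀ m : ℤ, val q x = exp m → x ≠ 0 := by
      rintro x m hx rfl
      rw [map_zero] at hx
      exact exp_ne_zero hx.symm
    rcases vnorm_eq_or (k₁ := k₁) (k₂ := k₂) (q := q) w with h0 | h0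
    · rw [hN, ← exp_add] at h0
      have hw0 := hne _ _ h0
      -- Clear the coordinate in which `w` attains its norm; the other one becomes `wedge w v / w
      -- 0`.
      refine ⟨(v : Fin 2 → K) 0 / w 0, ?_⟩
      have e0 : ((v : Fin 2 → K) - ((v : Fin 2 → K) 0 / w 0) • w) 0 = 0 := by
        simp [hw0]
      have e1 : ((v : Fin 2 → K) - ((v : Fin 2 → K) 0 / w 0) • w) 1 = wedge w v / w 0 := by
        simp only [Pi.sub_apply, Pi.smul_apply, smul_eq_mul, wedge]
        field_simp
      rw [vnorm_le_exp_iff, e0, e1, map_zero, map_div₀, h0, div_eq_mul_inv, ← exp_neg,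
        mul_exp_le_exp_iff]
      refine ⟨zero_le, h.trans ?_⟩
      rw [exp_le_exp, hyp_add]
      linarith
    · rw [hN, ← exp_add] at h0
      have hw1 := hne _ _ h0
      refine ⟨(v : Fin 2 → K) 1 / w 1, ?_⟩
      have e1 : ((v : Fin 2 → K) - ((v : Fin 2 → K) 1 / w 1) • w) 1 = 0 := by
        simp [hw1]
      have e0 : ((v : Fin 2 → K) - ((v : Fin 2 → K) 1 / w 1) • w) 0 = -(wedge w v / w 1) := by
        simp only [Pi.sub_apply, Pi.smul_apply, smul_eq_mul, wedge]
        field_simp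
        ring
      rw [vnorm_le_exp_iff, e0, e1, map_zero, Valuation.map_neg, map_div₀, h0, div_eq_mul_inv,
        ← exp_neg, mul_exp_le_exp_iff]
      refine ⟨h.trans ?_, zero_le⟩
      rw [exp_le_exp, hyp_add]
      linarith

/-- A generator of the saturation of `K · w` spans the line in the fibre. -/
theorem lineAt_eq_span {w : Fin 2 → K} (v : stalkV k₁ k₂ q) {f : K}
    (hv : (v : Fin 2 → K) = f • w) (h1 : vnorm k₁ k₂ q (v : Fin 2 → K) = 1) :
    lineAt k₁ k₂ w q = Submodule.span ℂ {evalAt k₁ k₂ q v} := by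
  have hf : f ≠ 0 := by
    rintro rfl
    rw [hv, vnorm_smul] at h1
    simp at h1
  refine le_antisymm ?_ ?_
  · intro x hx
    obtain ⟨u, rfl⟩ := evalAt_surjective x
    obtain ⟨r, hr, hru⟩ := (mem_lineAt_iff_exists w u).mp hx
    have hrw : r • w = (r / f) • (v : Fin 2 → K) := by
      rw [hv, smul_smul, div_mul_cancel₀ _ hf]
    rw [hrw, vnorm_smul, h1, mul_one] at hr
    -- Modulo the maximal ideal the coefficient `r / f` is a constant.
    obtain ⟨c, hc⟩ := exists_val_sub_lt_one q hr
    refine Submodule.mem_span_singleton.mpr ⟨c, ?_⟩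
    rw [← map_smul, eq_comm, evalAt_eq_evalAt_iff]
    have : (u : Fin 2 → K) - ((c • v : stalkV k₁ k₂ q) : Fin 2 → K) =
        ((u : Fin 2 → K) - r • w) - (algebraMap ℂ K c - r / f) • (v : Fin 2 → K) := by
      rw [hrw, sub_smul, algebraMap_smul, Submodule.coe_smul]
      abel
    rw [this]
    refine (vnorm_sub_le _ _).trans (max_le hru ?_)
    rw [vnorm_smul, h1, mul_one, Valuation.map_sub_swap, ← lt_one_iff_le_exp]
    exact hc
  · rw [Submodule.span_singleton_le_iff_mem, mem_lineAt_iff_exists]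
    refine ⟨f, ?_, ?_⟩
    · rw [← hv, h1]
    · rw [← hv, sub_self, ← zero_smul K (v : Fin 2 → K), vnorm_smul, map_zero, zero_mul]
      exact zero_le

theorem exists_generator {w : Fin 2 → K} (hw : w ≠ 0) :
    ∃ (v : stalkV k₁ k₂ q) (f : K), (v : Fin 2 → K) = f • w ∧
      vnorm k₁ k₂ q (v : Fin 2 → K) = 1 := by
  obtain ⟨N, hN⟩ := exists_eq_exp (vnorm_ne_zero (k₁ := k₁) (k₂ := k₂) (q := q) hw)
  obtain ⟨f, hf⟩ := exists_val_eq_exp q (-N)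
  have h1 : vnorm k₁ k₂ q (f • w) = 1 := by
    rw [vnorm_smul, hf, hN, ← exp_add, neg_add_cancel, exp_zero]
  exact ⟨⟨f • w, (mem_stalkV_iff _).mpr h1.le⟩, f, rfl, h1⟩

theorem evalAt_ne_zero {v : stalkV k₁ k₂ q} (h1 : vnorm k₁ k₂ q (v : Fin 2 → K) = 1) :
    evalAt k₁ k₂ q v ≠ 0 := by
  rw [ne_eq, evalAt_eq_zero_iff, h1, ← exp_zero, exp_le_exp]
  norm_num

theorem finrank_lineAt {w : Fin 2 → K} (hw : w ≠ 0) :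
    Module.finrank ℂ (lineAt k₁ k₂ w q) = 1 := by
  obtain ⟨v, f, hv, h1⟩ := exists_generator (k₁ := k₁) (k₂ := k₂) (q := q) hw
  rw [lineAt_eq_span v hv h1]
  exact finrank_span_singleton (evalAt_ne_zero h1)

end

/-! ### Sections of a line bundle on `ℙ(V)` along the curve of a line subbundle -/

theorem eq_of_le_of_finrank_eq_one {k V : Type*} [Field k] [AddCommGroup V] [Module k V]
    {A B : Submodule k V} (h : A ≤ B) (hA : Module.finrank k A = 1)
    (hB : Module.finrank k B = 1) : A = B := by
  have : FiniteDimensional k B := FiniteDimensional.of_finrank_pos (by omega)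
  exact Submodule.eq_of_le_of_finrank_eq h (hA.trans hB.symm)

variable {k₁ k₂ : ℤ}

/-- The point over `q` of the curve in `ℙ(V)` defined by the line `K · w`. -/
def curvePt (k₁ k₂ : ℤ) {w : Fin 2 → K} (hw : w ≠ 0) (q : Pt) : PV k₁ k₂ :=
  ⟨q, Projectivization.mk'' (lineAt k₁ k₂ w q) (finrank_lineAt hw)⟩

theorem curvePt_line_submodule {w : Fin 2 → K} (hw : w ≠ 0) (q : Pt) :
    (curvePt k₁ k₂ hw q).line.submodule = lineAt k₁ k₂ w q :=
  Projectivization.submodule_mk'' _ _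

theorem mem_range_curvePt_iff {w : Fin 2 → K} (hw : w ≠ 0) (q : Pt) (l : ℙ ℂ (Fibre k₁ k₂ q)) :
    (⟨q, l⟩ : PV k₁ k₂) ∈ Set.range (curvePt k₁ k₂ hw) ↔ l.submodule = lineAt k₁ k₂ w q := by
  constructor
  · rintro ⟨q', h⟩
    obtain rfl : q' = q := congrArg PV.base h
    simp only [curvePt, PV.mk.injEq, heq_eq_eq, true_and] at h
    rw [← h, Projectivization.submodule_mk'']
  · intro h
    refine ⟨q, ?_⟩
    have : l = Projectivization.mk'' (lineAt k₁ k₂ w q) (finrank_lineAt hw) :=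
      Projectivization.submodule_injective (h.trans (Projectivization.submodule_mk'' _ _).symm)
    rw [this]
    rfl

theorem eval_smul_of_isHomogeneous {G : MvPolynomial (Fin 2) K} {j : ℕ} (hG : G.IsHomogeneous j)
    (r : K) (v : Fin 2 → K) :
    MvPolynomial.eval (r • v) G = r ^ j * MvPolynomial.eval v G := by
  rw [MvPolynomial.eval_eq', MvPolynomial.eval_eq', Finset.mul_sum]
  refine Finset.sum_congr rfl fun d hd => ?_
  have hdeg : ∑ i, d i = j := by
    rw [← hG (MvPolynomial.mem_support_iff.mp hd), Finsupp.weight_apply,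
      Finsupp.sum_fintype _ _ (by simp)]
    simp
  simp only [Pi.smul_apply, smul_eq_mul, mul_pow]
  rw [Finset.prod_mul_distrib, Finset.prod_pow_eq_pow_sum, hdeg]
  ring

/-- The value of a section of `Sym^j V^∨ ⊗ 𝒪(m)` modulo `𝔪_q` depends only on the class of `v` in
the fibre. With `u = t u'` and `t` a uniformiser, restrict `G` to the line `v + s u'`: this is a
polynomial in `s` bounded on constants, and it changes by a multiple of `t` between `s = 0` and `s =
t`. -/
theorem val_eval_add_sub_le {j : ℕ} {m : ℤ} {G : MvPolynomial (Fin 2) K}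
    (hG : IsSection k₁ k₂ j m G) (q : Pt) {v u : Fin 2 → K} (hv : vnorm k₁ k₂ q v ≤ 1)
    (hu : vnorm k₁ k₂ q u ≤ exp (-1 : ℤ)) :
    val q (MvPolynomial.eval (v + u) G - MvPolynomial.eval v G) ≤ exp (hyp m q - 1) := by
  obtain ⟨t, ht⟩ := exists_val_eq_exp q (-1)
  have ht0 : t ≠ 0 := by
    rintro rfl
    rw [map_zero] at ht
    exact exp_ne_zero ht.symm
  set u' := t⁻¹ • u with hu'
  have hu'1 : vnorm k₁ k₂ q u' ≤ 1 := by
    rw [hu', vnorm_smul, map_inv₀, ht, ← exp_neg, neg_neg, mul_comm, ← exp_zero,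
      mul_exp_le_exp_iff]
    simpa using hu
  set P : K[X] := MvPolynomial.aeval
    (fun i => Polynomial.C (v i) + Polynomial.X * Polynomial.C (u' i)) G with hP
  have hPe : ∀ s : K, P.eval s = MvPolynomial.eval (v + s • u') G := by
    intro s
    rw [hP, ← Polynomial.coe_evalRingHom, MvPolynomial.aeval_def, MvPolynomial.hom_eval₂,
      MvPolynomial.eval, MvPolynomial.coe_eval₂Hom]
    congr 1
    · ext x
      simp
    · ext i
      simp only [Polynomial.coe_evalRingHom, Polynomial.eval_add,
        Polynomial.eval_mul, Polynomial.eval_X, Polynomial.eval_C, Pi.add_apply, Pi.smul_apply,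
        smul_eq_mul]
  have h0 : val q t * exp (hyp m q) = exp (hyp m q - 1) := by
    rw [ht, ← exp_add]
    congr 1
    ring
  have key := val_eval_sub_eval_zero_le q (exp (hyp m q)) P (fun c => ?_) (r := t) ?_
  · rw [hPe, hPe, h0, hu', smul_smul, mul_inv_cancel₀ ht0, one_smul, zero_smul, add_zero] at key
    exact key
  · rw [hPe]
    refine hG.2 q _ ?_
    rw [algebraMap_smul]
    exact Submodule.add_mem _ ((mem_stalkV_iff _).mpr hv)
      (Submodule.smul_mem _ _ ((mem_stalkV_iff _).mpr hu'1))
  · rw [ht, ← exp_zero, exp_le_exp]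
    norm_num

/-- If `G(w) = 0`, the whole curve lies in the zero locus. Otherwise, away from `∞` and from the
zeros and poles of `G(w)` and of the nonzero coordinates of `w`, the vector `w` generates its line
and `G(w)` is a unit. -/
theorem finite_curvePt_mem_zeroLocus {w : Fin 2 → K} (hw : w ≠ 0) {j : ℕ} {m : ℤ}
    {G : MvPolynomial (Fin 2) K} (hG : IsSection k₁ k₂ j m G) {q₀ : Pt}
    (hq₀ : curvePt k₁ k₂ hw q₀ ∉ zeroLocus k₁ k₂ m G) :
    {q | curvePt k₁ k₂ hw q ∈ zeroLocus k₁ k₂ m G}.Finite := by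
  have hne : MvPolynomial.eval w G ≠ 0 := by
    intro h
    refine hq₀ fun v hv => ?_
    rw [curvePt_line_submodule] at hv
    obtain ⟨r, hr, hrv⟩ := (mem_lineAt_iff_exists w v).mp hv
    have key := val_eval_add_sub_le hG q₀ hr hrv
    rw [add_sub_cancel, eval_smul_of_isHomogeneous hG.1, h, mul_zero, sub_zero] at key
    change val q₀ _ ≤ exp ((hyp m - Finsupp.single q₀ 1 : Divisor) q₀)
    simpa using key
  obtain ⟨i, hi⟩ : ∃ i, w i ≠ 0 := Function.ne_iff.mp hw
  refine (((finite_val_ne_one hne).union (finite_val_ne_one hi)).union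
    ((Set.finite_singleton OnePoint.infty).union
      (Set.finite_iUnion fun i : {i // w i ≠ 0} => finite_val_ne_one i.2))).subset ?_
  intro q hq
  by_contra hcon
  simp only [Set.mem_union, not_or, Set.mem_iUnion, not_exists, Set.mem_ofPred_eq, not_not,
    Set.mem_singleton_iff] at hcon
  obtain ⟨⟨hGq, hwq⟩, hinf, hall⟩ := hcon
  have hall' : ∀ i, val q (w i) ≤ 1 := fun i => by
    by_cases h : w i = 0
    · simp [h]
    · exact (hall ⟨i, h⟩).le
  have hn : vnorm k₁ k₂ q w = 1 := by
    rw [vnorm, hyp_of_ne _ hinf, hyp_of_ne _ hinf, neg_zero, exp_zero, mul_one, mul_one]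
    refine le_antisymm (max_le (hall' 0) (hall' 1)) ?_
    rw [← hwq, le_max_iff]
    fin_cases i
    · exact Or.inl le_rfl
    · exact Or.inr le_rfl
  have hmem := hq ⟨w, (mem_stalkV_iff _).mpr hn.le⟩ (by
    rw [curvePt_line_submodule]
    refine (mem_lineAt_iff_exists w _).mpr ⟨1, ?_, ?_⟩
    · rw [one_smul, hn]
    · rw [one_smul, sub_self, ← zero_smul K w, vnorm_smul, map_zero, zero_mul]
      exact zero_le)
  change val q (MvPolynomial.eval w G) ≤ exp ((hyp m - Finsupp.single q 1 : Divisor) q) at hmem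
  rw [hGq, Finsupp.sub_apply, hyp_of_ne _ hinf, Finsupp.single_eq_same, ← exp_zero,
    exp_le_exp] at hmem
  norm_num at hmem

/-- The curve of a line subbundle is irreducible. -/
theorem isIrreducible_range_curvePt {w : Fin 2 → K} (hw : w ≠ 0) :
    IsIrreducible (Set.range (curvePt k₁ k₂ hw)) := by
  -- An open set that meets the curve misses only finitely many of its points, as one checks on the
  -- generators of the topology. Two such sets meet because `ℙ¹` is infinite.
  have key : ∀ U : Set (PV k₁ k₂), IsOpen U → (Set.range (curvePt k₁ k₂ hw) ∩ U).Nonempty →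
      {q | curvePt k₁ k₂ hw q ∉ U}.Finite := by
    intro U hU
    induction hU with
    | basic U hU =>
      obtain ⟨j, m, G, hG, rfl⟩ := hU
      rintro ⟨_, ⟨q₀, rfl⟩, hq₀⟩
      simpa using finite_curvePt_mem_zeroLocus hw hG hq₀
    | univ => intro _; simp
    | inter U U' _ _ ih ih' =>
      rintro ⟨x, hx, hxU, hxU'⟩
      refine ((ih ⟨x, hx, hxU⟩).union (ih' ⟨x, hx, hxU'⟩)).subset fun q hq => ?_
      by_contra h
      simp only [Set.mem_union, Set.mem_ofPred_eq, not_or, not_not] at h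
      exact hq h
    | sUnion S _ ih =>
      rintro ⟨x, hx, U, hU, hxU⟩
      exact (ih U hU ⟨x, hx, hxU⟩).subset fun q hq h => hq ⟨U, hU, h⟩
  refine ⟨Set.range_nonempty _, fun U U' hU hU' hne hne' => ?_⟩
  obtain ⟨q, hq⟩ := ((key U hU hne).union (key U' hU' hne')).infinite_compl.nonempty
  simp only [Set.mem_compl_iff, Set.mem_union, Set.mem_ofPred_eq, not_or, not_not] at hq
  exact ⟨_, ⟨q, rfl⟩, hq⟩

end

section

/-! ### Irreducible curves in the linear systems `|𝒪_V(1) ⊗ γ^* 𝒪(m)|` -/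

/-- The linear form `v ↦ w ∧ v` on `K²`. -/
def wedgeForm (w : Fin 2 → K) : MvPolynomial (Fin 2) K :=
  MvPolynomial.C (w 0) * MvPolynomial.X 1 - MvPolynomial.C (w 1) * MvPolynomial.X 0

theorem eval_wedgeForm (w v : Fin 2 → K) : MvPolynomial.eval v (wedgeForm w) = wedge w v := by
  simp [wedgeForm, wedge]

theorem isHomogeneous_wedgeForm (w : Fin 2 → K) : (wedgeForm w).IsHomogeneous 1 :=
  (MvPolynomial.isHomogeneous_C_mul_X _ _).sub (MvPolynomial.isHomogeneous_C_mul_X _ _)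

theorem wedgeForm_zero : wedgeForm 0 = 0 := by
  simp [wedgeForm]

theorem exists_eq_wedgeForm {F : MvPolynomial (Fin 2) K} (hF : F.IsHomogeneous 1) :
    ∃ w, F = wedgeForm w := by
  rw [← MvPolynomial.mem_homogeneousSubmodule, MvPolynomial.homogeneousSubmodule_one_eq_span_X,
    Submodule.mem_span_range_iff_exists_fun] at hF
  obtain ⟨c, rfl⟩ := hF
  refine ⟨![c 1, -c 0], ?_⟩
  simp [wedgeForm, MvPolynomial.smul_eq_C_mul, add_comm]

variable {k₁ k₂ : ℤ}

theorem wedgeForm_ne_zero {w : Fin 2 → K} (hw : w ≠ 0) : wedgeForm w ≠ 0 := by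
  intro h
  obtain ⟨v, -, hv⟩ := exists_val_wedge_eq (k₁ := 0) (k₂ := 0) (q := OnePoint.infty) w
  rw [← eval_wedgeForm, h, map_zero, map_zero, eq_comm, mul_eq_zero] at hv
  exact hv.elim (vnorm_ne_zero hw) exp_ne_zero

/-- The norm of the functional `w ∧ ·` on `V_q` is exactly `vnorm w` times that of `det V`. -/
theorem isSection_wedgeForm_iff {m : ℤ} {w : Fin 2 → K} :
    IsSection k₁ k₂ 1 m (wedgeForm w) ↔
      ∀ q, vnorm k₁ k₂ q w ≤ exp (hyp (m - (k₁ + k₂)) q) := by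
  constructor
  · intro h q
    obtain ⟨v, hv, hwv⟩ := exists_val_wedge_eq (k₁ := k₁) (k₂ := k₂) (q := q) w
    have : val q (MvPolynomial.eval v (wedgeForm w)) ≤ exp (hyp m q) := h.2 q v hv
    rwa [eval_wedgeForm, hwv, mul_exp_le_exp_iff, ← hyp_sub] at this
  · intro h
    refine ⟨isHomogeneous_wedgeForm w, fun q v hv => ?_⟩
    change val q _ ≤ exp (hyp m q)
    rw [eval_wedgeForm]
    have hv' := (mem_stalkV_iff v).mp hv
    calc _ ≤ _ := val_wedge_le w v
      _ ≤ exp (hyp (m - (k₁ + k₂)) q) * 1 * exp (hyp (k₁ + k₂) q) := by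
        gcongr
        exact h q
      _ = _ := by rw [mul_one, ← exp_add, ← hyp_add, sub_add_cancel]

theorem mem_zeroLocus_wedgeForm_iff {m : ℤ} {w : Fin 2 → K} {q : Pt}
    {l : ℙ ℂ (Fibre k₁ k₂ q)} :
    (⟨q, l⟩ : PV k₁ k₂) ∈ zeroLocus k₁ k₂ m (wedgeForm w) ↔
      ∀ v : stalkV k₁ k₂ q, evalAt k₁ k₂ q v ∈ l.submodule →
        val q (wedge w v) ≤ exp (hyp m q - 1) := by
  refine forall₂_congr fun v _ => ?_
  rw [eval_wedgeForm]
  change val q _ ≤ exp ((hyp m - Finsupp.single q 1 : Divisor) q) ↔ _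
  rw [Finsupp.sub_apply, Finsupp.single_eq_same]

/-- Equality of norms says that the form does not vanish on the fibre at `q`, so it kills exactly
one line. -/
theorem mem_zeroLocus_wedgeForm_iff_eq_lineAt {m : ℤ} {w : Fin 2 → K} (hw : w ≠ 0) {q : Pt}
    (hq : vnorm k₁ k₂ q w = exp (hyp (m - (k₁ + k₂)) q)) {l : ℙ ℂ (Fibre k₁ k₂ q)} :
    (⟨q, l⟩ : PV k₁ k₂) ∈ zeroLocus k₁ k₂ m (wedgeForm w) ↔
      l.submodule = lineAt k₁ k₂ w q := by
  have hiff : ∀ v : stalkV k₁ k₂ q, evalAt k₁ k₂ q v ∈ lineAt k₁ k₂ w q ↔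
      val q (wedge w v) ≤ exp (hyp m q - 1) := by
    intro v
    rw [mem_lineAt_iff hw, hq, ← exp_add, ← add_sub_assoc, ← hyp_add, sub_add_cancel]
  rw [mem_zeroLocus_wedgeForm_iff]
  constructor
  · intro h
    refine eq_of_le_of_finrank_eq_one (fun x hx => ?_) l.finrank_submodule (finrank_lineAt hw)
    obtain ⟨v, rfl⟩ := evalAt_surjective x
    exact (hiff v).mpr (h v hx)
  · intro h v hv
    rw [h] at hv
    exact (hiff v).mp hv

/-- The saturation of `K · w` in `V` is `𝒪(-d · ∞) · w`. -/
def IsPrimitive (k₁ k₂ d : ℤ) (w : Fin 2 → K) : Prop :=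
  ∀ q, vnorm k₁ k₂ q w = exp (hyp d q)

theorem IsPrimitive.ne_zero {d : ℤ} {w : Fin 2 → K} (h : IsPrimitive k₁ k₂ d w) : w ≠ 0 := by
  rintro rfl
  have := h OnePoint.infty
  rw [← zero_smul K (0 : Fin 2 → K), vnorm_smul, map_zero, zero_mul] at this
  exact exp_ne_zero this.symm

theorem IsPrimitive.range_curvePt_mem {d : ℤ} {w : Fin 2 → K} (h : IsPrimitive k₁ k₂ d w) :
    Set.range (curvePt k₁ k₂ h.ne_zero) ∈ irreducibleCurves k₁ k₂ (degV k₁ k₂ + d) := by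
  have h' : ∀ q, vnorm k₁ k₂ q w = exp (hyp (degV k₁ k₂ + d - (k₁ + k₂)) q) := fun q => by
    rw [h q, degV, add_sub_cancel_left]
  refine ⟨⟨wedgeForm w, wedgeForm_ne_zero h.ne_zero,
    isSection_wedgeForm_iff.mpr fun q => (h' q).le, ?_⟩, isIrreducible_range_curvePt _⟩
  ext ⟨q, l⟩
  rw [mem_range_curvePt_iff, mem_zeroLocus_wedgeForm_iff_eq_lineAt h.ne_zero (h' q)]

/-! ### Irreducible members come from primitive vectors -/

theorem isClosed_zeroLocus {j : ℕ} {m : ℤ} {F : MvPolynomial (Fin 2) K}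
    (hF : IsSection k₁ k₂ j m F) : IsClosed (zeroLocus k₁ k₂ m F) :=
  ⟨TopologicalSpace.isOpen_generateFrom_of_mem ⟨j, m, F, hF, rfl⟩⟩

/-- The fibre is cut out by a form of degree zero, namely a section of `𝒪(1)` whose only zero is
`q₀`. -/
theorem isClosed_fibre (q₀ : Pt) : IsClosed {x : PV k₁ k₂ | x.base = q₀} := by
  obtain ⟨h, hh⟩ := exists_hasDiv_of_degree_eq_zero
    (D := Finsupp.single q₀ 1 - hyp 1) (by
      rw [sub_eq_add_neg, Divisor.degree_add, Divisor.degree_neg, Divisor.degree_hyp,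
        Divisor.degree_single]
      norm_num)
  have hsec : IsSection k₁ k₂ 0 1 (MvPolynomial.C h) := by
    refine ⟨MvPolynomial.isHomogeneous_C _ _, fun q v _ => ?_⟩
    change val q _ ≤ exp (hyp 1 q)
    rw [MvPolynomial.eval_C, hh q, exp_le_exp, Finsupp.sub_apply]
    have : (0 : ℤ) ≤ (Finsupp.single q₀ 1 : Divisor) q := by
      classical
      rw [Finsupp.single_apply]
      split_ifs <;> norm_num
    linarith
  convert isClosed_zeroLocus hsec using 1
  ext ⟨q, l⟩
  have hval : val q h ≤ exp ((hyp 1 - Finsupp.single q 1 : Divisor) q) ↔ q = q₀ := by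
    classical
    rw [hh q, exp_le_exp, Finsupp.sub_apply, Finsupp.sub_apply, Finsupp.single_eq_same,
      Finsupp.single_apply]
    constructor
    · intro h'
      by_contra hne
      rw [if_neg (Ne.symm hne)] at h'
      linarith
    · rintro rfl
      rw [if_pos rfl]
      linarith
  constructor
  · intro hq v _
    rw [MvPolynomial.eval_C]
    exact hval.mpr hq
  · intro hq
    -- A constant form takes its value even at the germ `0`, which belongs to every line.
    have := hq 0 (by rw [map_zero]; exact Submodule.zero_mem _)
    rw [MvPolynomial.eval_C] at this
    exact hval.mp this

/-- A section that vanishes on a whole fibre has a reducible zero locus. -/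
theorem not_isIrreducible_of_lt {m : ℤ} {w : Fin 2 → K} (hw : w ≠ 0)
    (hsec : ∀ q, vnorm k₁ k₂ q w ≤ exp (hyp (m - (k₁ + k₂)) q)) {q₀ : Pt}
    (hlt : vnorm k₁ k₂ q₀ w < exp (hyp (m - (k₁ + k₂)) q₀)) :
    ¬ IsIrreducible (zeroLocus k₁ k₂ m (wedgeForm w)) := by
  intro hirr
  obtain ⟨N, hN⟩ := exists_eq_exp (vnorm_ne_zero (k₁ := k₁) (k₂ := k₂) (q := q₀) hw)
  -- The form vanishes to order `e` along the fibre over `q₀`; multiplication by `h`, with divisor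
  -- `e · ∞ - e · q₀`, removes this fibre.
  obtain ⟨e, he⟩ : ∃ e, e = hyp (m - (k₁ + k₂)) q₀ - N := ⟨_, rfl⟩
  obtain ⟨h, hh⟩ := exists_hasDiv_of_degree_eq_zero
    (D := -Finsupp.single q₀ e + hyp e) (by
      rw [Divisor.degree_add, Divisor.degree_neg, Divisor.degree_hyp, Divisor.degree_single]
      ring)
  have hw' : h • w ≠ 0 := smul_ne_zero hh.ne_zero hw
  have hh0 : val q₀ h = exp (e - hyp e q₀) := by
    rw [hh q₀, Finsupp.add_apply, Finsupp.neg_apply, Finsupp.single_eq_same]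
    congr 1
    ring
  have hh1 : ∀ q, q ≠ q₀ → val q h = exp (-hyp e q) := by
    intro q hq
    rw [hh q, Finsupp.add_apply, Finsupp.neg_apply, Finsupp.single_eq_of_ne hq, neg_zero, zero_add]
  have hn0 : vnorm k₁ k₂ q₀ (h • w) = exp (hyp (m - e - (k₁ + k₂)) q₀) := by
    rw [vnorm_smul, hN, hh0, ← exp_add, sub_right_comm, hyp_sub _ e, he]
    congr 1
    ring
  have hsec' : IsSection k₁ k₂ 1 (m - e) (wedgeForm (h • w)) := by
    rw [isSection_wedgeForm_iff]
    intro q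
    by_cases hq : q = q₀
    · rw [hq, hn0]
    · rw [vnorm_smul, hh1 q hq, sub_right_comm, hyp_sub _ e, mul_comm, mul_exp_le_exp_iff]
      simpa using hsec q
  have hfib : ∀ l : ℙ ℂ (Fibre k₁ k₂ q₀),
      (⟨q₀, l⟩ : PV k₁ k₂) ∈ zeroLocus k₁ k₂ m (wedgeForm w) := by
    intro l
    rw [mem_zeroLocus_wedgeForm_iff]
    intro v _
    have hv' := (mem_stalkV_iff _).mp v.2
    rw [lt_exp_iff] at hlt
    calc _ ≤ _ := val_wedge_le w v
      _ ≤ exp (hyp (m - (k₁ + k₂)) q₀ - 1) * 1 * exp (hyp (k₁ + k₂) q₀) := by gcongr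
      _ = _ := by
        rw [mul_one, ← exp_add]
        congr 1
        rw [hyp_sub]
        ring
  have hsub : zeroLocus k₁ k₂ m (wedgeForm w) ⊆
      {x | x.base = q₀} ∪ zeroLocus k₁ k₂ (m - e) (wedgeForm (h • w)) := by
    rintro ⟨q, l⟩ hx
    by_cases hq : q = q₀
    · exact Or.inl hq
    · right
      rw [mem_zeroLocus_wedgeForm_iff] at hx ⊢
      intro v hv
      rw [wedge_smul_left, map_mul, hh1 q hq, mul_comm, mul_exp_le_exp_iff, hyp_sub]
      convert hx v hv using 2
      ring
  -- Neither piece is everything: the zero locus has points over every other `q`, and it contains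
  -- the whole fibre over `q₀`, where the residual form vanishes on one line only.
  rcases isPreirreducible_iff_isClosed_union_isClosed.mp hirr.2 _ _ (isClosed_fibre q₀)
    (isClosed_zeroLocus hsec') hsub with hcase | hcase
  · obtain ⟨q, hq⟩ := exists_ne q₀
    refine hq (@hcase (curvePt k₁ k₂ hw q) ?_)
    rw [curvePt, mem_zeroLocus_wedgeForm_iff]
    intro v hv
    rw [Projectivization.submodule_mk'', mem_lineAt_iff hw] at hv
    calc _ ≤ _ := hv
      _ ≤ exp (hyp (m - (k₁ + k₂)) q) * exp (hyp (k₁ + k₂) q - 1) := by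
        gcongr
        exact hsec q
      _ = _ := by
        rw [← exp_add]
        congr 1
        rw [hyp_sub]
        ring
  · obtain ⟨v, hv, hwv⟩ := exists_val_wedge_eq (k₁ := k₁) (k₂ := k₂) (q := q₀) (h • w)
    have hnot : evalAt k₁ k₂ q₀ ⟨v, hv⟩ ∉ lineAt k₁ k₂ (h • w) q₀ := by
      rw [mem_lineAt_iff hw', hwv, hn0, ← exp_add, ← exp_add, exp_le_exp]
      linarith
    have hv0 : evalAt k₁ k₂ q₀ ⟨v, hv⟩ ≠ 0 := fun h0 => hnot (h0 ▸ Submodule.zero_mem _)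
    have hmem := hcase (hfib (Projectivization.mk ℂ _ hv0))
    rw [mem_zeroLocus_wedgeForm_iff_eq_lineAt hw' hn0, Projectivization.submodule_mk] at hmem
    exact hnot (hmem ▸ Submodule.mem_span_singleton_self _)

theorem exists_isPrimitive_of_mem_irreducibleCurves {d : ℤ} {Z : Set (PV k₁ k₂)}
    (hZ : Z ∈ irreducibleCurves k₁ k₂ (degV k₁ k₂ + d)) :
    ∃ (w : Fin 2 → K) (h : IsPrimitive k₁ k₂ d w), Z = Set.range (curvePt k₁ k₂ h.ne_zero) := by
  obtain ⟨⟨F, hF0, hF, rfl⟩, hirr⟩ := hZ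
  obtain ⟨w, rfl⟩ := exists_eq_wedgeForm hF.1
  have hw : w ≠ 0 := by
    rintro rfl
    exact hF0 wedgeForm_zero
  rw [isSection_wedgeForm_iff] at hF
  have heq : ∀ q, vnorm k₁ k₂ q w = exp (hyp (degV k₁ k₂ + d - (k₁ + k₂)) q) := fun q =>
    (hF q).eq_or_lt.resolve_right fun hlt => not_isIrreducible_of_lt hw hF hlt hirr
  have hprim : IsPrimitive k₁ k₂ d w := fun q => by
    rw [heq q, degV, add_sub_cancel_left]
  refine ⟨w, hprim, ?_⟩
  ext ⟨q, l⟩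
  rw [mem_range_curvePt_iff, mem_zeroLocus_wedgeForm_iff_eq_lineAt hw (heq q)]

/-- A nonzero coordinate of `w` is a section of `𝒪(d + k₁)` or `𝒪(d + k₂)`, which forces that degree
to be nonnegative. -/
theorem IsPrimitive.min_le {d : ℤ} {w : Fin 2 → K} (h : IsPrimitive k₁ k₂ d w) :
    min (-k₁) (-k₂) ≤ d := by
  have key : ∀ (i : Fin 2) (k : ℤ), w i ≠ 0 → (∀ q, val q (w i) ≤ exp (hyp (d + k) q)) →
      -k ≤ d := by
    intro i k hi hk
    obtain ⟨D, hD, hdiv⟩ := exists_hasDiv hi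
    have hle : (-D).degree ≤ (hyp (d + k)).degree := Divisor.degree_le_degree fun q => by
      rw [← exp_le_exp, Finsupp.neg_apply, ← hdiv q]
      exact hk q
    rw [Divisor.degree_neg, hD, Divisor.degree_hyp] at hle
    linarith
  by_cases h0 : w 0 = 0
  · have h1 : w 1 ≠ 0 := fun h1 => h.ne_zero (funext fun i => by fin_cases i <;> assumption)
    refine (min_le_right _ _).trans (key 1 k₂ h1 fun q => ?_)
    rw [hyp_add, exp_add, ← h q]
    exact val_apply_one_le w
  · refine (min_le_left _ _).trans (key 0 k₁ h0 fun q => ?_)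
    rw [hyp_add, exp_add, ← h q]
    exact val_apply_zero_le w

theorem exists_isPrimitive_smul {w : Fin 2 → K} {D : Divisor}
    (h : ∀ q, vnorm k₁ k₂ q w = exp (-(D q))) :
    ∃ g : K, g ≠ 0 ∧ IsPrimitive k₁ k₂ (-D.degree) (g • w) := by
  obtain ⟨g, hg⟩ := exists_hasDiv_sub_hyp (-D)
  refine ⟨g, hg.ne_zero, fun q => ?_⟩
  rw [vnorm_smul, hg q, h q, ← exp_add, Divisor.degree_neg, Finsupp.sub_apply, Finsupp.neg_apply]
  congr 1
  ring

end

section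

/-! ### Saturated parabolic subsheaves of rank one -/

namespace Parabolic

variable {k₁ k₂ : ℤ} {n : ℕ} {p : Fin n → Pt}

open scoped Classical in
/-- The weight at `p i` induced on the saturation of `K · w`. -/
def inducedWeight (E : Parabolic k₁ k₂ p) (w : Fin 2 → K) (i : Fin n) : ℝ :=
  if E.flag i = lineAt k₁ k₂ w (p i) then E.a i else E.b i

theorem neg_one_lt_inducedWeight (E : Parabolic k₁ k₂ p) (w : Fin 2 → K) (i : Fin n) :
    -1 < E.inducedWeight w i := by
  rw [inducedWeight]
  split_ifs
  · exact E.neg_one_lt i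
  · exact (E.neg_one_lt i).trans_le (E.le i)

theorem inducedWeight_nonpos (E : Parabolic k₁ k₂ p) (w : Fin 2 → K) (i : Fin n) :
    E.inducedWeight w i ≤ 0 := by
  rw [inducedWeight]
  split_ifs
  · exact (E.le i).trans (E.nonpos i)
  · exact E.nonpos i

/-- The induced weight is the first step of the filtration that contains a generator of the line. If
`a i = b i`, the flag is zero and the middle step does not occur. -/
theorem evalAt_mem_fil_iff (E : Parabolic k₁ k₂ p) {w : Fin 2 → K} (hw : w ≠ 0) (i : Fin n)
    (v : stalkV k₁ k₂ (p i)) {f : K} (hv : (v : Fin 2 → K) = f • w)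
    (h1 : vnorm k₁ k₂ (p i) (v : Fin 2 → K) = 1) (s : ℝ) :
    evalAt k₁ k₂ (p i) v ∈ E.fil i s ↔ E.inducedWeight w i ≤ s := by
  have hne := evalAt_ne_zero h1
  have hspan := lineAt_eq_span v hv h1
  have hab := E.le i
  rw [fil]
  split_ifs with ha hb
  · refine iff_of_false (fun h => hne ((Submodule.mem_bot ℂ).mp h)) (not_le.mpr ?_)
    rw [inducedWeight]
    split_ifs <;> linarith
  · have hflag := E.finrank_flag i (by linarith)
    have : evalAt k₁ k₂ (p i) v ∈ E.flag i ↔ E.flag i = lineAt k₁ k₂ w (p i) := by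
      constructor
      · intro h
        refine (eq_of_le_of_finrank_eq_one ?_ (finrank_lineAt hw) hflag).symm
        rw [hspan, Submodule.span_singleton_le_iff_mem]
        exact h
      · intro h
        rw [h, hspan]
        exact Submodule.mem_span_singleton_self _
    rw [this, inducedWeight]
    split_ifs with h
    · exact iff_of_true h (by linarith)
    · exact iff_of_false h (by linarith)
  · refine iff_of_true Submodule.mem_top ?_
    rw [inducedWeight]
    split_ifs <;> linarith

theorem mem_levelStalk_iff (E : Parabolic k₁ k₂ p) (t : Fin n → ℝ) (q : Pt) (v : Fin 2 → K) :
    v ∈ E.levelStalk t q ↔ vnorm k₁ k₂ q v ≤ 1 ∧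
      ∀ i, p i = q → ∃ h : v ∈ stalkV k₁ k₂ (p i), evalAt k₁ k₂ (p i) ⟨v, h⟩ ∈ E.fil i (t i) := by
  rw [levelStalk, Submodule.mem_inf, mem_stalkV_iff]
  refine and_congr_right fun _ => ?_
  simp only [Submodule.mem_iInf, Submodule.mem_map, Submodule.mem_comap, Submodule.subtype_apply]
  refine forall₂_congr fun i _ => ?_
  constructor
  · rintro ⟨u, hu, rfl⟩
    exact ⟨u.2, hu⟩
  · rintro ⟨h, hv⟩
    exact ⟨⟨v, h⟩, hv, rfl⟩

/-- The divisor of the level sheaf `L_t`. -/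
def _root_.ParP1.ParLine.levelDivisor (p : Fin n → Pt) (L : ParLine n) (t : Fin n → ℝ) :
    Divisor :=
  L.D + ∑ i, Finsupp.single (p i) ⌊t i - L.e i⌋

theorem _root_.ParP1.ParLine.smul_mem_levelStalk_iff (L : ParLine n) (t : Fin n → ℝ) (q : Pt)
    (f : K) : f • L.w ∈ L.levelStalk p t q ↔ val q f ≤ exp (L.levelDivisor p t q) := by
  constructor
  · rintro ⟨g, hg, hgf⟩
    have : g = f := smul_left_injective K L.w_ne_zero hgf
    rw [← this]
    exact hg
  · intro h
    exact ⟨f, h, rfl⟩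

theorem _root_.ParP1.ParLine.levelDivisor_apply_of_notMem (L : ParLine n) (t : Fin n → ℝ) {q : Pt}
    (hq : ∀ i, p i ≠ q) : L.levelDivisor p t q = L.D q := by
  rw [ParLine.levelDivisor, Finsupp.add_apply, Finsupp.finsetSum_apply,
    Finset.sum_eq_zero fun i _ => Finsupp.single_eq_of_ne (hq i).symm, add_zero]

theorem _root_.ParP1.ParLine.levelDivisor_apply (hp : Function.Injective p) (L : ParLine n)
    (t : Fin n → ℝ) (i : Fin n) : L.levelDivisor p t (p i) = L.D (p i) + ⌊t i - L.e i⌋ := by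
  rw [ParLine.levelDivisor, Finsupp.add_apply, Finsupp.finsetSum_apply,
    Finset.sum_eq_single_of_mem i (Finset.mem_univ i) fun j _ hj =>
      Finsupp.single_eq_of_ne fun h => hj (hp h.symm), Finsupp.single_eq_same]

/-- A saturated parabolic subsheaf is at every level the intersection with `K · w`. -/
theorem isSaturatedSubsheaf_iff (E : Parabolic k₁ k₂ p) (L : ParLine n) :
    E.IsSaturatedSubsheaf L ↔ ∀ t, IsLevel t → ∀ q, ∀ f : K,
      val q f ≤ exp (L.levelDivisor p t q) ↔ f • L.w ∈ E.levelStalk t q := by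
  constructor
  · rintro ⟨hsub, hsat⟩ t ht q f
    rw [← L.smul_mem_levelStalk_iff]
    refine ⟨fun h => hsub t ht q h, fun h => ?_⟩
    by_cases hf : f = 0
    · rw [hf, zero_smul]
      exact Submodule.zero_mem _
    obtain ⟨N, hN⟩ := exists_eq_exp ((val q).ne_zero_iff.mpr hf)
    -- This `r` is regular at `q` and vanishes enough to bring `f` into the level sheaf, so
    -- saturation applies.
    obtain ⟨r, hr⟩ := exists_val_eq_exp q (min 0 (L.levelDivisor p t q - N))
    have hr0 : r ≠ 0 := by
      rintro rfl
      rw [map_zero] at hr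
      exact exp_ne_zero hr.symm
    refine hsat t ht q _ h r hr0 ?_ ?_
    · rw [hr, ← exp_zero, exp_le_exp]
      exact min_le_left _ _
    · rw [smul_smul, L.smul_mem_levelStalk_iff, map_mul, hr, hN, mul_exp_le_exp_iff, exp_le_exp]
      exact min_le_right _ _
  · intro h
    refine ⟨fun t ht q => ?_, fun t ht q v hv r hr _ hrv => ?_⟩
    · rintro _ ⟨f, hf, rfl⟩
      exact (h t ht q f).mp hf
    · obtain ⟨f, hf, hfv⟩ := hrv
      have hv' : v = (r⁻¹ * f) • L.w := by
        rw [← smul_smul, eq_inv_smul_iff₀ hr]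
        exact hfv.symm
      rw [hv', L.smul_mem_levelStalk_iff]
      rw [hv'] at hv
      exact (h t ht q _).mpr hv

theorem zero_le_floor_sub_iff {s e : ℝ} : 0 ≤ ⌊s - e⌋ ↔ e ≤ s := by
  rw [Int.floor_nonneg, sub_nonneg]

/-- For level and weight in `(-1, 0]` the floor is `0` or `-1`, and it jumps where they agree. -/
theorem floor_sub_of_le {s e : ℝ} (he : -1 < e) (hs : s ≤ 0) (h : e ≤ s) : ⌊s - e⌋ = 0 := by
  rw [Int.floor_eq_iff]
  constructor <;> push_cast <;> linarith

theorem floor_sub_of_lt {s e : ℝ} (he : e ≤ 0) (hs : -1 < s) (h : s < e) : ⌊s - e⌋ = -1 := by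
  rw [Int.floor_eq_iff]
  constructor <;> push_cast <;> linarith

/-- Level zero sees the full bundle and recovers the divisor; varying the level at `p i` for a local
generator then recovers the weight. -/
theorem isSaturatedSubsheaf_iff_inducedWeight (hp : Function.Injective p)
    (E : Parabolic k₁ k₂ p) (L : ParLine n) :
    E.IsSaturatedSubsheaf L ↔
      (∀ q, vnorm k₁ k₂ q L.w = exp (-(L.D q))) ∧ ∀ i, L.e i = E.inducedWeight L.w i := by
  rw [isSaturatedSubsheaf_iff]
  constructor
  · intro h
    have hD : ∀ q, vnorm k₁ k₂ q L.w = exp (-(L.D q)) := by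
      intro q
      obtain ⟨N, hN⟩ := exists_eq_exp (vnorm_ne_zero (k₁ := k₁) (k₂ := k₂) (q := q) L.w_ne_zero)
      have hdiv : L.levelDivisor p (fun _ => 0) q = L.D q := by
        by_cases hq : ∃ i, p i = q
        · obtain ⟨i, rfl⟩ := hq
          rw [ParLine.levelDivisor_apply hp,
            floor_sub_of_le (L.neg_one_lt i) le_rfl (L.nonpos i), add_zero]
        · exact L.levelDivisor_apply_of_notMem _ (not_exists.mp hq)
      have hfil : ∀ i, E.fil i 0 = ⊤ := fun i => by
        rw [fil, if_neg (not_lt.mpr ((E.le i).trans (E.nonpos i))),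
          if_neg (not_lt.mpr (E.nonpos i))]
      have hiff : ∀ f : K, val q f ≤ exp (L.D q) ↔ vnorm k₁ k₂ q (f • L.w) ≤ 1 := by
        intro f
        rw [← hdiv, h (fun _ => 0) (fun _ => by norm_num) q f, mem_levelStalk_iff]
        refine ⟨fun h => h.1, fun h => ⟨h, ?_⟩⟩
        rintro i rfl
        refine ⟨(mem_stalkV_iff _).mpr h, ?_⟩
        rw [hfil]
        exact Submodule.mem_top
      have hiff' : ∀ m : ℤ, m ≤ L.D q ↔ m + N ≤ 0 := by
        intro m
        obtain ⟨f, hf⟩ := exists_val_eq_exp q m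
        have := hiff f
        rwa [vnorm_smul, hf, hN, ← exp_add, ← exp_zero, exp_le_exp, exp_le_exp] at this
      have h1 := (hiff' (L.D q)).mp le_rfl
      have h2 := (hiff' (-N)).mpr (by simp)
      rw [hN, exp_inj]
      linarith
    refine ⟨hD, fun i => ?_⟩
    obtain ⟨f, hf⟩ := exists_val_eq_exp (p i) (L.D (p i))
    have h1 : vnorm k₁ k₂ (p i) (f • L.w) = 1 := by
      rw [vnorm_smul, hf, hD, ← exp_add, add_neg_cancel, exp_zero]
    have hst : f • L.w ∈ stalkV k₁ k₂ (p i) := (mem_stalkV_iff _).mpr h1.le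
    have hiff : ∀ s : ℝ, -1 < s → s ≤ 0 → (L.e i ≤ s ↔ E.inducedWeight L.w i ≤ s) := by
      intro s hs hs'
      rw [← E.evalAt_mem_fil_iff L.w_ne_zero i ⟨_, hst⟩ rfl h1]
      have := h (fun _ => s) (fun _ => ⟨hs, hs'⟩) (p i) f
      rw [hf, exp_le_exp, L.levelDivisor_apply hp, le_add_iff_nonneg_right,
        zero_le_floor_sub_iff, mem_levelStalk_iff] at this
      rw [this]
      constructor
      · rintro ⟨-, h⟩
        exact (h i rfl).2
      · refine fun h => ⟨h1.le, fun j hj => ?_⟩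
        obtain rfl := hp hj
        exact ⟨hst, h⟩
    -- Both weights are themselves admissible levels, so each can be tested against the other.
    exact le_antisymm
      ((hiff _ (E.neg_one_lt_inducedWeight _ i) (E.inducedWeight_nonpos _ i)).mpr le_rfl)
      ((hiff _ (L.neg_one_lt i) (L.nonpos i)).mp le_rfl)
  · rintro ⟨hD, he⟩ t ht q f
    rw [mem_levelStalk_iff]
    by_cases hq : ∃ i, p i = q
    · obtain ⟨i, rfl⟩ := hq
      rw [L.levelDivisor_apply hp]
      have hcond : (∀ j, p j = p i → ∃ h : f • L.w ∈ stalkV k₁ k₂ (p j),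
          evalAt k₁ k₂ (p j) ⟨f • L.w, h⟩ ∈ E.fil j (t j)) ↔
          ∃ h : f • L.w ∈ stalkV k₁ k₂ (p i),
            evalAt k₁ k₂ (p i) ⟨f • L.w, h⟩ ∈ E.fil i (t i) := by
        refine ⟨fun h => h i rfl, fun h j hj => ?_⟩
        obtain rfl := hp hj
        exact h
      rw [hcond]
      by_cases hf : f = 0
      · simp only [hf, map_zero, zero_le, true_iff, zero_smul]
        have h0 : (0 : Fin 2 → K) ∈ stalkV k₁ k₂ (p i) := Submodule.zero_mem _
        refine ⟨(mem_stalkV_iff _).mp h0, h0, ?_⟩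
        convert Submodule.zero_mem (E.fil i (t i))
        exact map_zero (evalAt k₁ k₂ (p i))
      obtain ⟨N, hN⟩ := exists_eq_exp ((val (p i)).ne_zero_iff.mpr hf)
      have hnorm : vnorm k₁ k₂ (p i) (f • L.w) = exp (N - L.D (p i)) := by
        rw [vnorm_smul, hN, hD, ← exp_add, sub_eq_add_neg]
      rw [hN, exp_le_exp]
      have hfloor : -1 ≤ ⌊t i - L.e i⌋ ∧ ⌊t i - L.e i⌋ ≤ 0 := by
        rcases le_or_gt (L.e i) (t i) with h | h
        · rw [floor_sub_of_le (L.neg_one_lt i) (ht i).2 h]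
          norm_num
        · rw [floor_sub_of_lt (L.nonpos i) (ht i).1 h]
          norm_num
      -- If `f • w` vanishes in the fibre, the flag imposes nothing and the floor is at least `-1`;
      -- if it generates the line, the weight decides; otherwise it is not in `V`.
      rcases lt_trichotomy N (L.D (p i)) with hlt | heq | hgt
      · have hle : vnorm k₁ k₂ (p i) (f • L.w) ≤ exp (-1 : ℤ) := by
          rw [hnorm, exp_le_exp]
          omega
        have hle1 : vnorm k₁ k₂ (p i) (f • L.w) ≤ 1 := by
          rw [hnorm, ← exp_zero, exp_le_exp]
          omega
        refine iff_of_true (by omega) ⟨hle1, (mem_stalkV_iff _).mpr hle1, ?_⟩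
        rw [(evalAt_eq_zero_iff _).mpr hle]
        exact Submodule.zero_mem _
      · have h1 : vnorm k₁ k₂ (p i) (f • L.w) = 1 := by
          rw [hnorm, heq, sub_self, exp_zero]
        have hst : f • L.w ∈ stalkV k₁ k₂ (p i) := (mem_stalkV_iff _).mpr h1.le
        have := E.evalAt_mem_fil_iff L.w_ne_zero i ⟨_, hst⟩ rfl h1 (t i)
        rw [heq, le_add_iff_nonneg_right, zero_le_floor_sub_iff, he i, ← this]
        exact ⟨fun h => ⟨h1.le, hst, h⟩, fun h => h.2.2⟩
      · refine iff_of_false (by omega) fun h => ?_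
        have := h.1
        rw [hnorm, ← exp_zero, exp_le_exp] at this
        omega
    · rw [L.levelDivisor_apply_of_notMem _ (not_exists.mp hq), vnorm_smul, hD, ← exp_zero,
        mul_exp_le_exp_iff, zero_sub, neg_neg]
      exact ⟨fun h => ⟨h, fun i hi => absurd ⟨i, hi⟩ hq⟩, fun h => h.1⟩

/-! ### Counting flags and comparing degrees -/

open scoped Classical in
theorem count_range_curvePt (E : Parabolic k₁ k₂ p) {w : Fin 2 → K} (hw : w ≠ 0) :
    E.count (Set.range (curvePt k₁ k₂ hw)) =
      (Finset.univ.filter fun i => E.flag i = lineAt k₁ k₂ w (p i)).card := by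
  rw [count, ← Set.ncard_coe_finset]
  congr 1
  ext i
  simp only [Set.mem_ofPred_eq, Finset.coe_filter, Finset.mem_univ, true_and]
  constructor
  · rintro ⟨l, hl, hmem⟩
    rw [mem_range_curvePt_iff] at hmem
    rw [← hl, hmem]
  · intro h
    refine ⟨Projectivization.mk'' _ (finrank_lineAt hw), ?_, ?_⟩
    · rw [Projectivization.submodule_mk'', h]
    · rw [mem_range_curvePt_iff, Projectivization.submodule_mk'']

/-- Each flag on the curve lowers one weight from `b` to `a`. -/
theorem sum_inducedWeight (E : Parabolic k₁ k₂ p) {a b : ℝ} (ha : ∀ i, E.a i = a)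
    (hb : ∀ i, E.b i = b) {w : Fin 2 → K} (hw : w ≠ 0) :
    ∑ i, E.inducedWeight w i = n * b - (b - a) * E.count (Set.range (curvePt k₁ k₂ hw)) := by
  classical
  have h : ∀ i, E.inducedWeight w i =
      b - (b - a) * if E.flag i = lineAt k₁ k₂ w (p i) then 1 else 0 := by
    intro i
    rw [inducedWeight, ha, hb]
    split_ifs <;> ring
  rw [count_range_curvePt, Finset.sum_congr rfl fun i _ => h i, Finset.sum_sub_distrib,
    ← Finset.mul_sum, Finset.sum_boole]
  simp

theorem range_curvePt_smul {g : K} (hg : g ≠ 0) {w : Fin 2 → K} (hw : w ≠ 0)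
    (hgw : g • w ≠ 0) :
    Set.range (curvePt k₁ k₂ hgw) = Set.range (curvePt k₁ k₂ hw) := by
  ext ⟨q, l⟩
  rw [mem_range_curvePt_iff, mem_range_curvePt_iff, lineAt_smul hg]

theorem count_le (E : Parabolic k₁ k₂ p) (Z : Set (PV k₁ k₂)) : E.count Z ≤ n := by
  rw [count]
  exact (Set.ncard_le_card _).trans (by simp)

theorem bddAbove_count (E : Parabolic k₁ k₂ p) (S : Set (Set (PV k₁ k₂))) :
    BddAbove (E.count '' S) :=
  ⟨n, by rintro _ ⟨Z, -, rfl⟩; exact E.count_le Z⟩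

/-- The numerical data of the saturated parabolic subsheaves of rank one: their degrees `-d` and
the numbers of flags on the corresponding irreducible curves. -/
theorem forall_pardeg_iff (hp : Function.Injective p) (E : Parabolic k₁ k₂ p) {a b : ℝ}
    (ha : ∀ i, E.a i = a) (hb : ∀ i, E.b i = b) (P : ℝ → Prop) :
    (∀ L, E.IsSaturatedSubsheaf L → P L.pardeg) ↔
      ∀ d : ℤ, ∀ Z ∈ irreducibleCurves k₁ k₂ (degV k₁ k₂ + d),
        P (-d - (n * b - (b - a) * E.count Z)) := by
  constructor
  · intro h d Z hZ
    obtain ⟨w, hw, rfl⟩ := exists_isPrimitive_of_mem_irreducibleCurves hZ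
    have := h ⟨hyp (-d), w, hw.ne_zero, E.inducedWeight w, E.neg_one_lt_inducedWeight w,
      E.inducedWeight_nonpos w⟩
      ((E.isSaturatedSubsheaf_iff_inducedWeight hp _).mpr
        ⟨fun q => by rw [hyp_neg, neg_neg]; exact hw q, fun _ => rfl⟩)
    rw [ParLine.pardeg] at this
    simp only at this
    rw [E.sum_inducedWeight ha hb hw.ne_zero, Divisor.degree_hyp, Int.cast_neg] at this
    exact this
  · intro h L hL
    obtain ⟨hD, he⟩ := (E.isSaturatedSubsheaf_iff_inducedWeight hp L).mp hL
    obtain ⟨g, hg, hprim⟩ := exists_isPrimitive_smul hD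
    have := h _ _ hprim.range_curvePt_mem
    rw [range_curvePt_smul hg L.w_ne_zero] at this
    rwa [ParLine.pardeg, Finset.sum_congr rfl fun i _ => he i,
      E.sum_inducedWeight ha hb L.w_ne_zero, ← neg_neg (L.D.degree : ℝ), ← Int.cast_neg]

/-- A downward closed condition holds for the flag counts of all irreducible curves if and only
if it holds for the maximal ones. -/
theorem forall_count_iff_forall_kd (E : Parabolic k₁ k₂ p) (P : ℤ → ℕ → Prop)
    (hP : ∀ d c c', c ≤ c' → P d c' → P d c) :
    (∀ d : ℤ, ∀ Z ∈ irreducibleCurves k₁ k₂ (degV k₁ k₂ + d), P d (E.count Z)) ↔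
      ∀ d : ℤ, min (-k₁) (-k₂) ≤ d → (irreducibleCurves k₁ k₂ (degV k₁ k₂ + d)).Nonempty →
        P d (E.kd d) := by
  constructor
  · intro h d _ hne
    -- The counts are bounded by `n`, so the supremum is attained on some curve.
    obtain ⟨Z, hZ, hZd⟩ := Nat.sSup_mem (hne.image E.count) (E.bddAbove_count _)
    rw [kd, ← hZd]
    exact h d Z hZ
  · intro h d Z hZ
    obtain ⟨w, hw, -⟩ := exists_isPrimitive_of_mem_irreducibleCurves hZ
    -- A given curve supplies both the nonemptiness and, through its primitive vector, the lower
    -- bound on `d`.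
    exact hP d _ _ (le_csSup (E.bddAbove_count _) ⟨Z, hZ, rfl⟩) (h d hw.min_le ⟨Z, hZ⟩)

theorem slope_eq (E : Parabolic k₁ k₂ p) {a b : ℝ} (ha : ∀ i, E.a i = a)
    (hb : ∀ i, E.b i = b) : E.slope = ((degV k₁ k₂ : ℝ) - n * (a + b)) / 2 := by
  simp [slope, pardeg, ha, hb, mul_add]

end Parabolic

end

end ParP1

end

theorem lemma2p1 (k₁ k₂ : ℤ) (n : ℕ) (p : Fin n → ParP1.Pt) (hp : Function.Injective p)
    (a b : ℚ) (E : ParP1.Parabolic k₁ k₂ p)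
    (ha : ∀ i, E.a i = (a : ℝ)) (hb : ∀ i, E.b i = (b : ℝ))
    (ha₁ : -1 < a) (hab : a ≤ b) (hb₀ : b ≤ 0) :
    (E.Semistable ↔
      ∀ d : ℤ, min (-k₁) (-k₂) ≤ d →
        (ParP1.irreducibleCurves k₁ k₂ (ParP1.degV k₁ k₂ + d)).Nonempty →
        ((b : ℝ) - a) * E.kd d ≤ (ParP1.degV k₁ k₂ : ℝ) / 2 + ((b : ℝ) - a) * (n / 2) + d) ∧
    (E.Stable ↔
      ∀ d : ℤ, min (-k₁) (-k₂) ≤ d →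
        (ParP1.irreducibleCurves k₁ k₂ (ParP1.degV k₁ k₂ + d)).Nonempty →
        ((b : ℝ) - a) * E.kd d < (ParP1.degV k₁ k₂ : ℝ) / 2 + ((b : ℝ) - a) * (n / 2) + d) := by
  have hab' : (0 : ℝ) ≤ (b : ℝ) - a := sub_nonneg.mpr (by exact_mod_cast hab)
  have hmono : ∀ c c' : ℕ, c ≤ c' → ((b : ℝ) - a) * c ≤ ((b : ℝ) - a) * c' := fun c c' h =>
    mul_le_mul_of_nonneg_left (by exact_mod_cast h) hab'
  constructor
  · rw [ParP1.Parabolic.Semistable, E.forall_pardeg_iff hp ha hb (· ≤ E.slope),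
      ← E.forall_count_iff_forall_kd
        (fun d c => ((b : ℝ) - a) * c ≤
          (ParP1.degV k₁ k₂ : ℝ) / 2 + ((b : ℝ) - a) * (n / 2) + d)
        fun d c c' h h' => (hmono c c' h).trans h', E.slope_eq ha hb]
    refine forall₃_congr fun d Z _ => ?_
    -- Both sides rearrange `-d - n b + (b - a) c ≤ (deg V - n (a + b)) / 2`.
    constructor <;> intro h <;> linarith
  · rw [ParP1.Parabolic.Stable, E.forall_pardeg_iff hp ha hb (· < E.slope),
      ← E.forall_count_iff_forall_kd
        (fun d c => ((b : ℝ) - a) * c <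
          (ParP1.degV k₁ k₂ : ℝ) / 2 + ((b : ℝ) - a) * (n / 2) + d)
        fun d c c' h h' => (hmono c c' h).trans_lt h', E.slope_eq ha hb]
    refine forall₃_congr fun d Z _ => ?_
    constructor <;> intro h <;> linarith
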